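/- **Setting.** Let $T_h$ be a finite set of closed triangles and rectangles in $\mathbb R^2$ with pairwise disjoint interiors, and let $\mathcal D$ be the interior of their union. Assume that $T_h$ is quasi-uniform with mesh width $h>0$: each element has diameter at most $h$ and contains a disc of radius $\sigma h$. Let $\partial\mathcal D_D\subset\partial\mathcal D$. Let $X^h$ be a finite-dimensional space of vector fields on $\overline{\mathcal D}$ whose components are conforming finite element functions, that is, single-valued functions that agree on each closed element with a polynomial of total degree at most $r$. Let $X_0^h=\{v\in X^h: v=0\text{ on }\partial\mathcal D_D\}$, let $X_E^h$ be the set of $v\in X^h$ that interpolate given Dirichlet data $\vec w$ at a set of nodes on $\partial\mathcal D_D$ (where a $v\in X^h$ that vanishes at the nodes vanishes on $\partial\mathcal D_D$), and let $Y^h\subset L_2(\mathcal D)$ be finite-dimensional. Assume that $(X_0^h,Y^h)$ is div-stable: for some $\beta>0$, every $0\neq q\in Y^h$ satisfies $\max_{0\ne v\in X_0^h}\int_{\mathcal D} q\,\nabla\!\cdot v/\|v\|_{H^1}\ge\beta\|q\|_{L_2}$. Let $\nu>0$, $\vec f\in L_2(\mathcal D)^2$, and let $\vec u^{(s)}\in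 X_E^h$, $p^{(s)}\in Y^h$ be a steady solution of the discrete Navier–Stokes equations: $\nu\int\nabla\vec u^{(s)}:\nabla v+\int(\vec u^{(s)}\cdot\nabla\vec u^{(s)})\cdot v-\int p^{(s)}\,\nabla\!\cdot v=\int\vec f\cdot v$ for all $v\in X_0^h$, and $\int q\,\nabla\!\cdot\vec u^{(s)}=0$ for all $q\in Y^h$. With respect to bases $\{e_i\}$ of $X_0^h$ and $\{g_i\}$ of $Y^h$ (of dimensions $n_u$, $n_p$) let $F_{ij}=a(e_j,e_i)$, where $a(\gamma,v)=\nu\int\nabla\gamma:\nabla v+\int(\vec u^{(s)}\cdot\nabla\gamma)\cdot v+\int(\gamma\cdot\nabla\vec u^{(s)})\cdot v$, and let $B_{ij}=-\int g_i\,\nabla\!\cdot e_j$ and $Q_{ij}=\int e_i\cdot e_j$. The eigenvalues of the unperturbed problem are the $\lambda\in\mathbb C$ for which $$\begin{bmatrix}F&B^T\\B&0\end{bmatrix}\begin{bmatrix}\mathbf u\\ \mathbf p\end{bmatrix}=\lambda\begin{bmatrix}-Q&0\\0&0\end{bmatrix}\begin{bmatrix}\mathbf u\\ \mathbf p\end{bmatrix}$$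 has a nonzero solution. Assume that this problem is diagonalizable, in the sense that $\ker B\subset\mathbb C^{n_u}$ has a basis formed by the velocity parts of eigenvectors; let $V$ be the matrix whose $m$ columns are such a basis, $\lambda_1,\dots,\lambda_m$ the corresponding eigenvalues, and $\kappa=\max_{|a|=1}\|Va\|_Q\,/\min_{|a|=1}\|Va\|_Q$ its condition number, with $\|z\|_Q^2=z^*Qz$ (the squared $L_2$ norm of the velocity). Let $\phi_h$ be a scalar conforming finite element function on $T_h$ (of any degree), and on each element $k$ let $\vec\delta_h^{(k)}=(-\partial_2\phi_h|_k,\partial_1\phi_h|_k)^T$; put $\|\delta_h\|_\infty=\max_k\max_{x\in k}|\vec\delta_h^{(k)}(x)|$. For scalar functions let $$c_h(u,v)=\sum_{k\in T_h}\Big(\int_k(\vec\delta_h^{(k)}\cdot\nabla u)\,v-\tfrac12\int_{\partial k}u\,v\,\vec\delta_h^{(k)}\cdot\vec n\Big),$$ with $\vec n$ the outward unit normal; for vector fields sum over the components. Let $N_{ij}=c_h(e_i,e_j)$. For $\alpha\in\mathbb R$ the eigenvalues of the perturbed problem are the $\hat\lambda\in\mathbb C$ for which $$\begin{bmatrix}F+N&B^T\\B&0\end{bmatrix}\begin{bmatrix}\mathbf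 u\\ \mathbf p\end{bmatrix}=\hat\lambda\begin{bmatrix}-Q&\alpha B^T\\\alpha B&0\end{bmatrix}\begin{bmatrix}\mathbf u\\ \mathbf p\end{bmatrix}$$ has a nonzero solution ($\alpha=0$ is allowed). **Theorem.** There is a constant $C>0$, depending only on $r$ and $\sigma$, such that for every discretization, steady solution, $V$, $\phi_h$ and $\alpha$ as above, and every rightmost eigenvalue $\lambda$ of the unperturbed problem (one of largest real part), the perturbed problem has an eigenvalue closest to $\lambda$, and every such closest eigenvalue $\hat\lambda$ satisfies $$|\hat\lambda-\lambda|\le\frac{c}{h}\,\|\delta_h\|_\infty\qquad\text{with } c=(2m-1)\,C\kappa .$$ If moreover the perturbation is so small that $2\,\frac{C\kappa}{h}\|\delta_h\|_\infty<|\lambda_j-\lambda|$ for all $j$ with $\lambda_j\ne\lambda$, then this holds with $c=C\kappa$. -/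

import Mathlib

open MeasureTheory

noncomputable section

namespace NSPerturb

/-- The Euclidean plane. -/
abbrev Plane := EuclideanSpace ℝ (Fin 2)

/-- Counterclockwise rotation by a right angle. -/
def rotCCW (v : Plane) : Plane := !₂[-(v 1), v 0]

/-- Clockwise rotation by a right angle. -/
def rotCW (v : Plane) : Plane := !₂[v 1, -(v 0)]

/-- The scalar cross product. -/
def cross (v w : Plane) : ℝ := v 0 * w 1 - v 1 * w 0

/-- Standard basis vectors of the plane. -/
def unitVec (i : Fin 2) : Plane := EuclideanSpace.single i 1

/-- A nondegenerate triangle with counterclockwise vertices `a, b, c`, or a nondegenerate rectangle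
with counterclockwise vertices `a, a + e, a + e + t e', a + t e'`, where `e'` is `e` rotated
counterclockwise by a right angle. -/
inductive Element where
  | triangle (a b c : Plane) (pos : 0 < cross (b - a) (c - a)) : Element
  | rectangle (a e : Plane) (t : ℝ) (he : e ≠ 0) (ht : 0 < t) : Element

namespace Element

/-- The directed edges, in counterclockwise order. -/
def edges : Element → List (Plane × Plane)
  | triangle a b c _ => [(a, b), (b, c), (c, a)]
  | rectangle a e t _ _ =>
      [(a, a + e), (a + e, a + e + t • rotCCW e),
        (a + e + t • rotCCW e, a + t • rotCCW e), (a + t • rotCCW e, a)]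

/-- The closed region covered by the element. -/
def region : Element → Set Plane
  | triangle a b c _ => convexHull ℝ {a, b, c}
  | rectangle a e t _ _ =>
      convexHull ℝ {a, a + e, a + e + t • rotCCW e, a + t • rotCCW e}

/-- The flux `∫_{∂k} g · n ds` with outward unit normal `n`. On the edge from `p` to `q`
(counterclockwise), `n ds` is the clockwise rotation of `q - p` times `dτ`. -/
def boundaryFlux (k : Element) (g : Plane → Plane) : ℝ :=
  (k.edges.map fun e =>
    ∫ τ in (0 : ℝ)..1, inner ℝ (g (e.1 + τ • (e.2 - e.1))) (rotCW (e.2 - e.1))).sum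

end Element

/-- The closed set covered by a finite family of elements. -/
def cover (T : Finset Element) : Set Plane := ⋃ k ∈ T, k.region

/-- The open polygonal domain that is subdivided by the elements. -/
def domain (T : Finset Element) : Set Plane := interior (cover T)

/-- A scalar conforming finite element function of degree at most `r`: on each closed element it
is a polynomial. As it is single valued on the closed elements it is continuous on the
closure of the domain, which for piecewise polynomials is the same as belonging to `H¹`.
The total degree bounds both the `P_r` elements and (with `r = 2 s`) the `Q_s` elements. -/
def IsFEFunction (T : Finset Element) (r : ℕ) (u : Plane → ℝ) : Prop :=
  ∀ k ∈ T, ∃ p : MvPolynomial (Fin 2) ℝ, p.totalDegree ≤ r ∧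
    ∀ x ∈ k.region, u x = MvPolynomial.eval (fun i => x i) p

/-- A mixed finite element discretization with velocities of (total) degree at most `r`. -/
structure Discretization (r : ℕ) where
  /-- The elements. -/
  mesh : Finset Element
  mesh_disjoint : ∀ k ∈ mesh, ∀ l ∈ mesh, k ≠ l →
    Disjoint (interior k.region) (interior l.region)
  /-- The Dirichlet part of the boundary. -/
  dirichlet : Set Plane
  dirichlet_subset : dirichlet ⊆ frontier (domain mesh)
  /-- The velocity space, without boundary conditions. Functions on the closed domain are
  extended by zero. -/
  X : Submodule ℝ (Plane → Plane)
  X_finite : FiniteDimensional ℝ X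
  X_fe : ∀ v ∈ X, ∀ i, IsFEFunction mesh r (fun x => v x i)
  X_support : ∀ v ∈ X, ∀ x, x ∉ cover mesh → v x = 0
  /-- The element nodes that lie on the Dirichlet boundary. -/
  nodes : Set Plane
  nodes_subset : nodes ⊆ dirichlet
  nodes_unisolvent : ∀ v ∈ X, (∀ x ∈ nodes, v x = 0) → ∀ x ∈ dirichlet, v x = 0
  /-- The pressure space. -/
  Y : Submodule ℝ (Lp ℝ 2 (volume.restrict (domain mesh)))
  Y_finite : FiniteDimensional ℝ Y

/-- The divergence. -/
def div (v : Plane → Plane) (x : Plane) : ℝ := ∑ i, fderiv ℝ v x (unitVec i) i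

/-- `∇u : ∇v`. -/
def gradDot (u v : Plane → Plane) (x : Plane) : ℝ :=
  ∑ i, ∑ j, fderiv ℝ u x (unitVec j) i * fderiv ℝ v x (unitVec j) i

/-- `(w · ∇u) · v`. -/
def convDot (w u v : Plane → Plane) (x : Plane) : ℝ :=
  inner ℝ (fderiv ℝ u x (w x)) (v x)

/-- On the element `k`, the field `curl φ = (-∂φ/∂x₂, ∂φ/∂x₁)`; the derivatives are those of the
restriction of `φ` to the closed element, so that on the boundary of `k` they are the limits
from inside `k`. -/
def curlOn (φ : Plane → ℝ) (k : Element) (x : Plane) : Plane :=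
  !₂[-(fderivWithin ℝ φ k.region x (unitVec 1)), fderivWithin ℝ φ k.region x (unitVec 0)]

namespace Discretization

variable {r : ℕ} (D : Discretization r)

/-- The domain of the flow problem. -/
def dom : Set Plane := domain D.mesh

/-- The velocity space with homogeneous Dirichlet conditions. -/
def X0 : Submodule ℝ (Plane → Plane) where
  carrier := {v | v ∈ D.X ∧ ∀ x ∈ D.dirichlet, v x = 0}
  add_mem' := fun ha hb => ⟨D.X.add_mem ha.1 hb.1, fun x hx => by
    simp [ha.2 x hx, hb.2 x hx]⟩
  zero_mem' := ⟨D.X.zero_mem, fun _ _ => rfl⟩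
  smul_mem' := fun c _ ha => ⟨D.X.smul_mem c ha.1, fun x hx => by
    simp [ha.2 x hx]⟩

/-- The velocities that interpolate the Dirichlet data `w` at the nodes. -/
def XE (w : Plane → Plane) : Set (Plane → Plane) := {v | v ∈ D.X ∧ ∀ x ∈ D.nodes, v x = w x}

/-- Quasi-uniformity with mesh width `h`: every element has diameter at most `h` and contains a
disc of radius `σ h`. -/
def QuasiUniform (σ h : ℝ) : Prop :=
  ∀ k ∈ D.mesh, Metric.diam k.region ≤ h ∧ ∃ x, Metric.ball x (σ * h) ⊆ k.region

/-- The `H¹` norm of a velocity. -/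
def h1Norm (v : Plane → Plane) : ℝ :=
  Real.sqrt ((∫ x in D.dom, ‖v x‖ ^ 2) + ∫ x in D.dom, gradDot v v x)

/-- The form `∫ q div v`. -/
def divForm (q : Lp ℝ 2 (volume.restrict (domain D.mesh))) (v : Plane → Plane) : ℝ :=
  ∫ x in D.dom, q x * div v x

/-- Div-stability (the discrete inf-sup condition) with constant `β`. -/
def DivStable (β : ℝ) : Prop :=
  ∀ q ∈ D.Y, q ≠ 0 → ∃ v ∈ D.X0, 0 < D.h1Norm v ∧ β * ‖q‖ * D.h1Norm v ≤ D.divForm q v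

/-- `(u, p)` is a steady solution of the discrete weak Navier-Stokes equations with viscosity `ν`,
body force `f` and Dirichlet data `w`. -/
def IsSteadySolution (ν : ℝ) (f w u : Plane → Plane)
    (p : Lp ℝ 2 (volume.restrict (domain D.mesh))) : Prop :=
  u ∈ D.XE w ∧ p ∈ D.Y ∧
  (∀ v ∈ D.X0, ν * (∫ x in D.dom, gradDot u v x) + (∫ x in D.dom, convDot u u v x)
      - D.divForm p v = ∫ x in D.dom, inner ℝ (f x) (v x)) ∧
  ∀ q ∈ D.Y, -D.divForm q u = 0

/-- The linearized convection-diffusion form `a(γ, v; u)`. -/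
def aForm (ν : ℝ) (u γ v : Plane → Plane) : ℝ :=
  ν * (∫ x in D.dom, gradDot γ v x) + (∫ x in D.dom, convDot u γ v x)
    + ∫ x in D.dom, convDot γ u v x

/-- The element form `∫_k (δ · ∇u) v - ½ ∫_{∂k} u v δ · n` for scalar `u`, `v`, `δ = curl φ`. -/
def cElement (φ : Plane → ℝ) (k : Element) (u v : Plane → ℝ) : ℝ :=
  (∫ x in k.region, fderivWithin ℝ u k.region x (curlOn φ k x) * v x)
    - (1 / 2) * k.boundaryFlux (fun x => (u x * v x) • curlOn φ k x)

/-- The nondissipative perturbation `c_h(u, v; δ_h)`, the sum over elements and components. -/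
def cForm (φ : Plane → ℝ) (u v : Plane → Plane) : ℝ :=
  ∑ k ∈ D.mesh, ∑ i, cElement φ k (fun x => u x i) (fun x => v x i)

/-- `‖δ_h‖_∞` for the elementwise curl `δ_h` of `φ`. -/
def deltaSup (φ : Plane → ℝ) : ℝ :=
  sSup {y | ∃ k ∈ D.mesh, ∃ x ∈ k.region, y = ‖curlOn φ k x‖}

variable {nu np : ℕ}

/-- The matrix of the linearized convection-diffusion form. -/
def matF (ν : ℝ) (u : Plane → Plane) (e : Module.Basis (Fin nu) ℝ D.X0) :
    Matrix (Fin nu) (Fin nu) ℝ :=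
  Matrix.of fun i j => D.aForm ν u (e j) (e i)

/-- The negative divergence matrix. -/
def matB (e : Module.Basis (Fin nu) ℝ D.X0) (g : Module.Basis (Fin np) ℝ D.Y) :
    Matrix (Fin np) (Fin nu) ℝ :=
  Matrix.of fun i j => -D.divForm (g i) (e j)

/-- The velocity mass matrix. -/
def matQ (e : Module.Basis (Fin nu) ℝ D.X0) : Matrix (Fin nu) (Fin nu) ℝ :=
  Matrix.of fun i j =>
    ∫ x in D.dom, inner ℝ ((e i : Plane → Plane) x) ((e j : Plane → Plane) x)

/-- The perturbation matrix, `(u, N v) = c_h(u_h, v_h; δ_h)`. -/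
def matN (φ : Plane → ℝ) (e : Module.Basis (Fin nu) ℝ D.X0) : Matrix (Fin nu) (Fin nu) ℝ :=
  Matrix.of fun i j => D.cForm φ (e i) (e j)

end Discretization

section Spectral

/-- A real matrix regarded as a complex one. -/
def toC {m n : Type*} (A : Matrix m n ℝ) : Matrix m n ℂ := A.map Complex.ofReal

/-- The (finite) eigenvalues of the generalized problem `A z = μ M z`. -/
def genSpectrum {ι : Type*} [Fintype ι] (A M : Matrix ι ι ℝ) : Set ℂ :=
  {μ | ∃ z : ι → ℂ, z ≠ 0 ∧ (toC A).mulVec z = μ • (toC M).mulVec z}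

variable {nu np m : ℕ}

/-- The saddle point matrix `[F Bᵀ; B 0]`. -/
def saddle (F : Matrix (Fin nu) (Fin nu) ℝ) (B : Matrix (Fin np) (Fin nu) ℝ) :
    Matrix (Fin nu ⊕ Fin np) (Fin nu ⊕ Fin np) ℝ :=
  Matrix.fromBlocks F B.transpose B 0

/-- The mass matrix `[-Q αBᵀ; αB 0]`; `α = 0` is the unmodified one. -/
def massMat (α : ℝ) (Q : Matrix (Fin nu) (Fin nu) ℝ) (B : Matrix (Fin np) (Fin nu) ℝ) :
    Matrix (Fin nu ⊕ Fin np) (Fin nu ⊕ Fin np) ℝ :=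
  Matrix.fromBlocks (-Q) (α • B.transpose) (α • B) 0

/-- `μ` is a rightmost element of `S`. -/
def IsRightmost (S : Set ℂ) (μ : ℂ) : Prop := μ ∈ S ∧ ∀ η ∈ S, η.re ≤ μ.re

/-- `η` is an element of `S` closest to `μ`. -/
def IsClosest (S : Set ℂ) (μ η : ℂ) : Prop := η ∈ S ∧ ∀ ζ ∈ S, ‖η - μ‖ ≤ ‖ζ - μ‖

/-- Diagonalizability of the finite part of the problem
`[F Bᵀ; B 0] (u, p) = μ [-Q 0; 0 0] (u, p)`: the columns of `V` are the velocity parts of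
eigenvectors (with pressure parts the columns of `P` and eigenvalues `Λ`) and form a basis of the
discretely divergence-free coefficient vectors. -/
structure IsEigenbasis (F : Matrix (Fin nu) (Fin nu) ℝ) (B : Matrix (Fin np) (Fin nu) ℝ)
    (Q : Matrix (Fin nu) (Fin nu) ℝ) (V : Matrix (Fin nu) (Fin m) ℂ)
    (P : Matrix (Fin np) (Fin m) ℂ) (Λ : Fin m → ℂ) : Prop where
  momentum : toC F * V + toC B.transpose * P = -(toC Q * V * Matrix.diagonal Λ)
  divFree : toC B * V = 0
  injective : Function.Injective V.mulVec
  spans : ∀ z : Fin nu → ℂ, (toC B).mulVec z = 0 → ∃ a, V.mulVec a = z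

/-- The norm `(z* Q z)^{1/2}`, that is, the `L²` norm of the velocity with coefficients `z`. -/
def qNorm (Q : Matrix (Fin nu) (Fin nu) ℝ) (z : Fin nu → ℂ) : ℝ :=
  Real.sqrt (dotProduct (star z) ((toC Q).mulVec z)).re

/-- The condition number of `V` as a map from Euclidean space to the velocities with the `L²` norm
is at most `κ`. -/
def CondLE (Q : Matrix (Fin nu) (Fin nu) ℝ) (V : Matrix (Fin nu) (Fin m) ℂ) (κ : ℝ) : Prop :=
  ∀ a b : Fin m → ℂ, ∑ j, ‖a j‖ ^ 2 = ∑ j, ‖b j‖ ^ 2 →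
    qNorm Q (V.mulVec a) ≤ κ * qNorm Q (V.mulVec b)

end Spectral

end NSPerturb

end

/-!
Three facts combine. First, `N` is small relative to `Q`: on a closed element the values and
gradients of a polynomial of degree at most `r` are controlled by its `L²` norm over the inscribed
disc (rescale to unit size and use that the polynomials form a finite-dimensional space). Since the
discs are disjoint, Cauchy–Schwarz over the elements bounds `yᵀ N x` by a multiple of
`h⁻¹ ‖δ‖_∞ ‖y‖_Q ‖x‖_Q`.

Second, in the coordinates given by the columns of `V`, the perturbed problem on the discretely
divergence-free velocities is the eigenvalue problem of `diag Λ + E` with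
`‖E‖ ≤ 2 (C / h) ‖δ‖_∞ κ`, and its eigenvalues are eigenvalues of the perturbed problem for every
`α`: multiplying the pressure by `(1 - μ α)⁻¹` turns a solution for `α = 0` into one for `α`.

Third, by the Bauer–Fike theorem the eigenvalues of `diag Λ + t E`, `0 ≤ t ≤ 1`, lie in the discs of
radius `‖E‖` about the `Λ j`. A circle about `Λ i` that avoids these discs cannot be crossed as `t`
goes from `0` to `1`, hence still encloses an eigenvalue of `diag Λ + E`. The radii of
circles that meet a disc are covered by `[0, ‖E‖]` and `m - 1` intervals of length `2 ‖E‖`, so some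
radius below any given `R > (2 m - 1) ‖E‖` is admissible; if the other discs are separated from the
one about `Λ i`, all radii slightly larger than `‖E‖` are.
-/

namespace NSPerturb

section DiagonalPerturbation

theorem exists_mem_Icc_lt_abs_sub {n : Type*} [Fintype n] (d : n → ℝ) {i : n} (hi : d i = 0)
    {ε R : ℝ} (hε : 0 ≤ ε) (hR : (2 * (Fintype.card n : ℝ) - 1) * ε < R) :
    ∃ ρ ∈ Set.Icc 0 R, ∀ j, ε < |ρ - d j| := by
  classical
  by_contra! hc
  have hcard : 1 ≤ Fintype.card n := Fintype.card_pos_iff.mpr ⟨i⟩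
  -- Since `d i = 0`, the interval about `d i` meets `[0, R]` only in `[0, ε]`, so the total length
  -- is `(2 * card n - 1) * ε` and not `2 * card n * ε`.
  have hcover : Set.Icc 0 R ⊆ Set.Icc 0 ε ∪
      ⋃ j ∈ Finset.univ.erase i, Set.Icc (d j - ε) (d j + ε) := by
    intro ρ hρ
    obtain ⟨j, hj⟩ := hc ρ hρ
    rw [abs_le] at hj
    by_cases hji : j = i
    · subst hji
      exact Or.inl ⟨hρ.1, by linarith [hj.2]⟩
    · refine Or.inr (Set.mem_iUnion₂.mpr ⟨j, by simp [hji], ?_, ?_⟩) <;> linarith [hj.1, hj.2]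
  have hvol : ENNReal.ofReal R ≤
      ENNReal.ofReal ε + ∑ _j ∈ Finset.univ.erase i, ENNReal.ofReal (2 * ε) := by
    calc ENNReal.ofReal R = volume (Set.Icc 0 R) := by simp
      _ ≤ volume (Set.Icc 0 ε) + ∑ j ∈ Finset.univ.erase i, volume (Set.Icc (d j - ε) (d j + ε)) :=
          (measure_mono hcover).trans <| (measure_union_le _ _).trans <| by
            gcongr
            exact measure_biUnion_finset_le _ _
      _ = _ := by simp only [Real.volume_Icc, sub_zero, add_sub_sub_cancel, two_mul]
  rw [Finset.sum_const, Finset.card_erase_of_mem (Finset.mem_univ i), Finset.card_univ,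
    ← ENNReal.ofReal_nsmul, ← ENNReal.ofReal_add hε (by positivity),
    ENNReal.ofReal_le_ofReal_iff (by positivity), nsmul_eq_mul, Nat.cast_sub hcard,
    Nat.cast_one] at hvol
  linarith

open scoped Matrix.Norms.L2Operator

variable {n : Type*} [Fintype n] [DecidableEq n]

theorem exists_mem_spectrum_norm_sub_lt (M : Matrix n n ℂ) (z : ℂ) {d : ℝ} (hd : 0 < d)
    (h : ‖M.charpoly.eval z‖ < d ^ Fintype.card n) : ∃ y ∈ spectrum ℂ M, ‖z - y‖ < d := by
  by_contra! hfar
  have hsplits := IsAlgClosed.splits M.charpoly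
  have hcard : M.charpoly.roots.card = Fintype.card n := by
    rw [← hsplits.natDegree_eq_card_roots, M.charpoly_natDegree_eq_dim]
  refine h.not_ge ?_
  calc d ^ Fintype.card n = (M.charpoly.roots.map fun _ => d).prod := by simp [hcard]
    _ ≤ (M.charpoly.roots.map fun y => ‖z - y‖).prod :=
        Multiset.prod_map_le_prod_map₀ _ _ (fun _ _ => hd.le) fun y hy =>
          hfar y (M.mem_spectrum_iff_isRoot_charpoly.mpr (Polynomial.isRoot_of_mem_roots hy))
    _ = ‖M.charpoly.eval z‖ := by
        rw [hsplits.eval_eq_prod_roots_of_monic M.charpoly_monic]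
        exact (M.charpoly.roots.prod_hom' (normHom : ℂ →*₀ ℝ) fun y => z - y)

theorem lowerHemicontinuous_spectrum :
    LowerHemicontinuous (spectrum ℂ : Matrix n n ℂ → Set ℂ) := by
  rw [lowerHemicontinuous_iff_isOpen_inter_nonempty]
  refine fun U hU => isOpen_iff_mem_nhds.mpr ?_
  rintro M ⟨z, hz, hzU⟩
  obtain ⟨d, hd, hball⟩ := Metric.isOpen_iff.mp hU z hzU
  have hcont : Continuous fun M : Matrix n n ℂ => ‖M.charpoly.eval z‖ := by
    simp only [Matrix.eval_charpoly]
    exact (continuous_const.sub continuous_id).matrix_det.norm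
  have hroot : ‖M.charpoly.eval z‖ = 0 := by
    rw [M.mem_spectrum_iff_isRoot_charpoly.mp hz, norm_zero]
  filter_upwards [hcont.continuousAt.eventually_lt_const (hroot.trans_lt (pow_pos hd _))]
    with M' hM'
  obtain ⟨y, hy, hzy⟩ := exists_mem_spectrum_norm_sub_lt M' z hd hM'
  exact ⟨y, hy, hball (by rwa [Metric.mem_ball, dist_comm, dist_eq_norm])⟩

theorem spectrum_inter_nonempty_of_disjoint_frontier {X : Type*} [TopologicalSpace X]
    [PreconnectedSpace X] {M : X → Matrix n n ℂ} (hM : Continuous M) {K : Set ℂ}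
    (hK : IsClosed K) (hdisj : ∀ x, Disjoint (spectrum ℂ (M x)) (frontier K)) {x₀ : X}
    (hx₀ : (spectrum ℂ (M x₀) ∩ K).Nonempty) (x : X) : (spectrum ℂ (M x) ∩ K).Nonempty := by
  have hinterior : ∀ x, spectrum ℂ (M x) ∩ K = spectrum ℂ (M x) ∩ interior K := fun x =>
    (Set.inter_subset_inter_right _ interior_subset).antisymm' fun z hz => ⟨hz.1, by
      by_contra hzi
      exact Set.disjoint_left.mp (hdisj x) hz.1 (hK.frontier_eq ▸ ⟨hz.2, hzi⟩)⟩
  have hclosed : IsClosed {x | (spectrum ℂ (M x) ∩ K).Nonempty} := by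
    have h := upperHemicontinuous_iff_isClosed_compl_preimage_Iic_compl.mp
      (upperHemicontinuous_spectrum ℂ (Matrix n n ℂ)) K hK
    convert h.preimage hM using 1
    ext x
    simp [Set.Nonempty, Set.subset_def]
  have hopen : IsOpen {x | (spectrum ℂ (M x) ∩ K).Nonempty} := by
    simp only [hinterior]
    exact (lowerHemicontinuous_iff_isOpen_inter_nonempty.mp lowerHemicontinuous_spectrum _
      isOpen_interior).preimage hM
  exact (IsClopen.eq_univ ⟨hclosed, hopen⟩ ⟨x₀, hx₀⟩).ge (Set.mem_univ x)

theorem exists_norm_sub_le_of_mem_spectrum_diagonal_add {Λ : n → ℂ} {E : Matrix n n ℂ} {z : ℂ}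
    (hz : z ∈ spectrum ℂ (Matrix.diagonal Λ + E)) : ∃ j, ‖z - Λ j‖ ≤ ‖E‖ := by
  by_contra! hfar
  have hne : ∀ j, z - Λ j ≠ 0 := fun j => norm_pos_iff.mp ((norm_nonneg E).trans_lt (hfar j))
  cases isEmpty_or_nonempty n
  · simp at hz
  let D : (Matrix n n ℂ)ˣ :=
    ⟨Matrix.diagonal fun j => z - Λ j, Matrix.diagonal fun j => (z - Λ j)⁻¹,
      by simp [Matrix.diagonal_mul_diagonal, hne], by simp [Matrix.diagonal_mul_diagonal, hne]⟩
  obtain ⟨j, hj⟩ := Finite.exists_max fun j => ‖(z - Λ j)⁻¹‖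
  have hD : ‖(↑D⁻¹ : Matrix n n ℂ)‖ ≤ ‖z - Λ j‖⁻¹ := by
    rw [← norm_inv]
    exact (Matrix.l2_opNorm_diagonal _).trans_le
      ((pi_norm_le_iff_of_nonneg (norm_nonneg _)).mpr hj)
  have hclose : ‖(algebraMap ℂ _ z - (Matrix.diagonal Λ + E)) - ↑D‖ <
      ‖(↑D⁻¹ : Matrix n n ℂ)‖⁻¹ := by
    have hsub : (algebraMap ℂ _ z - (Matrix.diagonal Λ + E)) - ↑D = -E := by
      rw [show (D : Matrix n n ℂ) = algebraMap ℂ _ z - Matrix.diagonal Λ by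
        rw [Matrix.algebraMap_eq_diagonal, Matrix.diagonal_sub]; rfl]
      abel
    rw [hsub, norm_neg]
    exact (hfar j).trans_le ((le_inv_comm₀ (norm_pos_iff.mpr (hne j)) D⁻¹.norm_pos).mpr hD)
  exact spectrum.mem_iff.mp hz (D.ofNearby _ hclose).isUnit

theorem infDist_spectrum_diagonal_add_le_of_forall_lt_abs {Λ : n → ℂ} {E : Matrix n n ℂ} {i : n}
    {ρ : ℝ} (hρ : 0 ≤ ρ) (hfar : ∀ j, ‖E‖ < |ρ - ‖Λ j - Λ i‖|) :
    Metric.infDist (Λ i) (spectrum ℂ (Matrix.diagonal Λ + E)) ≤ ρ := by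
  let M : unitInterval → Matrix n n ℂ := fun t => Matrix.diagonal Λ + ((t : ℝ) : ℂ) • E
  have hM : Continuous M := by fun_prop
  have hdisj : ∀ t, Disjoint (spectrum ℂ (M t)) (frontier (Metric.closedBall (Λ i) ρ)) := by
    refine fun t => Set.disjoint_left.mpr fun z hz hzρ => ?_
    have hzρ := mem_sphere_iff_norm.mp (Metric.frontier_closedBall_subset_sphere hzρ)
    obtain ⟨j, hj⟩ := exists_norm_sub_le_of_mem_spectrum_diagonal_add hz
    have hE : ‖((t : ℝ) : ℂ) • E‖ ≤ ‖E‖ := by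
      rw [norm_smul, Complex.norm_real, Real.norm_of_nonneg t.2.1]
      exact mul_le_of_le_one_left (norm_nonneg _) t.2.2
    have habs := abs_norm_sub_norm_le (z - Λ i) (Λ j - Λ i)
    rw [sub_sub_sub_cancel_right, hzρ] at habs
    exact (hfar j).not_ge (habs.trans (hj.trans hE))
  have hstart : (spectrum ℂ (M 0) ∩ Metric.closedBall (Λ i) ρ).Nonempty :=
    ⟨Λ i, by simp [M], Metric.mem_closedBall_self hρ⟩
  obtain ⟨z, hz, hzρ⟩ := spectrum_inter_nonempty_of_disjoint_frontier hM
    Metric.isClosed_closedBall hdisj hstart 1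
  exact (Metric.infDist_le_dist_of_mem (by simpa [M] using hz)).trans
    (Metric.mem_closedBall'.mp hzρ)

theorem infDist_spectrum_diagonal_add_le (Λ : n → ℂ) (E : Matrix n n ℂ) (i : n) :
    Metric.infDist (Λ i) (spectrum ℂ (Matrix.diagonal Λ + E)) ≤
      (2 * (Fintype.card n : ℝ) - 1) * ‖E‖ := by
  refine le_of_forall_gt_imp_ge_of_dense fun R hR => ?_
  obtain ⟨ρ, hρ, hfar⟩ := exists_mem_Icc_lt_abs_sub (fun j => ‖Λ j - Λ i‖) (i := i) (by simp)
    (norm_nonneg E) hR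
  exact (infDist_spectrum_diagonal_add_le_of_forall_lt_abs hρ.1 hfar).trans hρ.2

theorem infDist_spectrum_diagonal_add_le_of_separated {Λ : n → ℂ} {E : Matrix n n ℂ} {i : n}
    (hsep : ∀ j, Λ j ≠ Λ i → 2 * ‖E‖ < ‖Λ j - Λ i‖) :
    Metric.infDist (Λ i) (spectrum ℂ (Matrix.diagonal Λ + E)) ≤ ‖E‖ := by
  refine le_of_forall_gt_imp_ge_of_dense fun R hR => ?_
  have hfar : ∀ᶠ ρ in nhdsWithin ‖E‖ (Set.Ioi ‖E‖), ∀ j, ‖E‖ < |ρ - ‖Λ j - Λ i‖| := by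
    refine Filter.eventually_all.mpr fun j => ?_
    by_cases hj : Λ j = Λ i
    · filter_upwards [self_mem_nhdsWithin] with ρ hρ
      simpa [hj] using lt_abs.mpr (Or.inl hρ)
    · have habs : ‖E‖ < |‖E‖ - ‖Λ j - Λ i‖| := lt_abs.mpr (Or.inr (by linarith [hsep j hj]))
      have hcont : Continuous fun ρ => |ρ - ‖Λ j - Λ i‖| := by fun_prop
      exact (hcont.continuousAt.eventually_const_lt habs).filter_mono nhdsWithin_le_nhds
  obtain ⟨ρ, ⟨hρ, hρR⟩, hfar⟩ :=
    ((Filter.eventually_of_mem (Ioo_mem_nhdsGT hR) fun _ => id).and hfar).exists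
  exact infDist_spectrum_diagonal_add_le_of_forall_lt_abs ((norm_nonneg E).trans hρ.le) hfar
    |>.trans hρR.le

end DiagonalPerturbation

section SaddlePoint

open Matrix
open scoped ComplexOrder Matrix.Norms.L2Operator

theorem isClosed_genSpectrum {ι : Type*} [Fintype ι] (A M : Matrix ι ι ℝ) :
    IsClosed (genSpectrum A M) := by
  classical
  have hdet : genSpectrum A M = {μ | (toC A - μ • toC M).det = 0} := by
    ext μ
    simp only [genSpectrum, Set.mem_ofPred_eq, ← exists_mulVec_eq_zero_iff, sub_mulVec, smul_mulVec,
      sub_eq_zero]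
  rw [hdet]
  exact isClosed_eq (by fun_prop) continuous_const

theorem exists_isClosest {S : Set ℂ} (hS : IsClosed S) (hne : S.Nonempty) (μ : ℂ) :
    ∃ η, IsClosest S μ η := by
  obtain ⟨η, hη, hdist⟩ := hS.exists_infDist_eq_dist hne μ
  refine ⟨η, hη, fun ζ hζ => ?_⟩
  rw [← dist_eq_norm, ← dist_eq_norm, dist_comm, ← hdist, dist_comm]
  exact Metric.infDist_le_dist_of_mem hζ

theorem IsClosest.norm_sub_le_infDist {S T : Set ℂ} {μ η : ℂ} (h : IsClosest S μ η) (hTS : T ⊆ S)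
    (hT : T.Nonempty) : ‖η - μ‖ ≤ Metric.infDist μ T :=
  (Metric.le_infDist hT).mpr fun ζ hζ => by
    rw [dist_comm, dist_eq_norm]
    exact h.2 ζ (hTS hζ)

theorem exact_conjTranspose_mulVec {𝕜 l m n : Type*} [RCLike 𝕜] [Fintype l] [Fintype m]
    [Fintype n] {V : Matrix n m 𝕜} {A : Matrix l n 𝕜}
    (h : Function.Exact V.mulVec A.mulVec) : Function.Exact Aᴴ.mulVec Vᴴ.mulVec := by
  classical
  have hVA : A * V = 0 := ext_iff_mulVec.mpr fun a => by
    rw [← mulVec_mulVec, zero_mulVec, h.apply_apply_eq_zero]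
  refine fun x => ⟨fun hx => ?_, ?_⟩
  · have horth : WithLp.toLp 2 x ∈ (toEuclideanLin A).kerᗮ := by
      rw [Submodule.mem_orthogonal]
      intro w hw
      obtain ⟨a, ha⟩ := (h w.ofLp).mp (by simpa [toLpLin_apply] using hw)
      rw [EuclideanSpace.inner_eq_star_dotProduct, dotProduct_comm, ← ha, star_mulVec,
        ← dotProduct_mulVec, hx, dotProduct_zero]
    rw [LinearMap.orthogonal_ker, ← toEuclideanLin_conjTranspose_eq_adjoint] at horth
    obtain ⟨p, hp⟩ := horth
    exact ⟨p.ofLp, congrArg WithLp.ofLp hp⟩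
  · rintro ⟨p, rfl⟩
    rw [mulVec_mulVec, ← conjTranspose_mul, hVA, conjTranspose_zero, zero_mulVec]

variable {nu np m : ℕ} {F N Q : Matrix (Fin nu) (Fin nu) ℝ} {B : Matrix (Fin np) (Fin nu) ℝ}
  {V : Matrix (Fin nu) (Fin m) ℂ} {P : Matrix (Fin np) (Fin m) ℂ} {Λ : Fin m → ℂ} {μ : ℂ}

theorem mem_genSpectrum_saddle_iff {α : ℝ} :
    μ ∈ genSpectrum (saddle F B) (massMat α Q B) ↔
      ∃ (u : Fin nu → ℂ) (p : Fin np → ℂ), (u ≠ 0 ∨ p ≠ 0) ∧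
        toC F *ᵥ u + (1 - μ * α) • ((toC B)ᴴ *ᵥ p) = -(μ • (toC Q *ᵥ u)) ∧
        (1 - μ * α) • (toC B *ᵥ u) = 0 := by
  have hA : toC (saddle F B) = fromBlocks (toC F) (toC B)ᴴ (toC B) 0 := by
    ext (i | i) (j | j) <;> simp [toC, saddle]
  have hM : toC (massMat α Q B) =
      fromBlocks (-toC Q) ((α : ℂ) • (toC B)ᴴ) ((α : ℂ) • toC B) 0 := by
    ext (i | i) (j | j) <;> simp [toC, massMat]
  have hblocks (u : Fin nu → ℂ) (p : Fin np → ℂ) :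
      (toC (saddle F B) *ᵥ Sum.elim u p = μ • (toC (massMat α Q B) *ᵥ Sum.elim u p)) ↔
        toC F *ᵥ u + (1 - μ * α) • ((toC B)ᴴ *ᵥ p) = -(μ • (toC Q *ᵥ u)) ∧
        (1 - μ * α) • (toC B *ᵥ u) = 0 := by
    simp only [hA, hM, fromBlocks_mulVec, Sum.elim_comp_inl, Sum.elim_comp_inr, zero_mulVec,
      add_zero, neg_mulVec, smul_mulVec, funext_iff, Sum.forall, Sum.elim_inl, Sum.elim_inr,
      Pi.add_apply, Pi.smul_apply, Pi.neg_apply, Pi.zero_apply, smul_eq_mul]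
    constructor <;> rintro ⟨h₁, h₂⟩ <;> exact
      ⟨fun i => by linear_combination h₁ i, fun i => by linear_combination h₂ i⟩
  constructor
  · rintro ⟨z, hz, h⟩
    rw [← Sum.elim_comp_inl_inr z] at h hz
    exact ⟨_, _, by rwa [← not_and_or, ← Sum.elim_eq_iff, Sum.elim_zero_zero], (hblocks _ _).mp h⟩
  · rintro ⟨u, p, hne, h⟩
    exact ⟨Sum.elim u p, by rwa [← Sum.elim_zero_zero, ne_eq, Sum.elim_eq_iff, not_and_or],
      (hblocks u p).mpr h⟩

theorem mem_genSpectrum_saddle_zero_iff :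
    μ ∈ genSpectrum (saddle F B) (massMat 0 Q B) ↔
      ∃ (u : Fin nu → ℂ) (p : Fin np → ℂ), (u ≠ 0 ∨ p ≠ 0) ∧
        toC F *ᵥ u + (toC B)ᴴ *ᵥ p = -(μ • (toC Q *ᵥ u)) ∧ toC B *ᵥ u = 0 := by
  simp [mem_genSpectrum_saddle_iff]

theorem genSpectrum_massMat_zero_subset (α : ℝ) :
    genSpectrum (saddle F B) (massMat 0 Q B) ⊆ genSpectrum (saddle F B) (massMat α Q B) := by
  intro μ hμ
  obtain ⟨u, p, hne, hmom, hdiv⟩ := mem_genSpectrum_saddle_zero_iff.mp hμ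
  rw [mem_genSpectrum_saddle_iff]
  by_cases hα : 1 - μ * α = 0
  · by_cases hp : p = 0
    · exact ⟨u, 0, by simpa [hp] using hne, by simpa [hp] using hmom, by simp [hα]⟩
    · exact ⟨0, p, Or.inr hp, by simp [hα], by simp⟩
  · refine ⟨u, (1 - μ * α)⁻¹ • p, hne.imp_right (smul_ne_zero (inv_ne_zero hα)), ?_, by simp [hdiv]⟩
    rw [mulVec_smul, smul_inv_smul₀ hα, hmom]

theorem IsRightmost.eq_zero_of_conjTranspose_mulVec_eq_zero
    (h : IsRightmost (genSpectrum (saddle F B) (massMat 0 Q B)) μ) {p : Fin np → ℂ}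
    (hp : (toC B)ᴴ *ᵥ p = 0) : p = 0 := by
  -- A nonzero kernel vector of `Bᴴ` would make every complex number an eigenvalue.
  by_contra hne
  have hre := h.2 (μ + 1)
    (mem_genSpectrum_saddle_zero_iff.mpr ⟨0, p, Or.inr hne, by simp [hp], by simp⟩)
  norm_num at hre

theorem IsEigenbasis.exact (h : IsEigenbasis F B Q V P Λ) :
    Function.Exact V.mulVec (toC B).mulVec := fun z => by
  refine ⟨h.spans z, ?_⟩
  rintro ⟨a, rfl⟩
  rw [mulVec_mulVec, h.divFree, zero_mulVec]

/-- The perturbation `-(V* Q V)⁻¹ V* N V` of the diagonal matrix of eigenvalues that `N` causes on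
the discretely divergence-free velocities, in the coordinates given by the columns of `V`. -/
noncomputable def reducedPert (N Q : Matrix (Fin nu) (Fin nu) ℝ) (V : Matrix (Fin nu) (Fin m) ℂ) :
    Matrix (Fin m) (Fin m) ℂ :=
  -((Vᴴ * toC Q * V)⁻¹ * (Vᴴ * toC N * V))

theorem mul_reducedPert (hQ : (toC Q).PosDef) (hV : Function.Injective V.mulVec) :
    (Vᴴ * toC Q * V) * reducedPert N Q V = -(Vᴴ * toC N * V) := by
  have hG := (isUnit_iff_isUnit_det _).mp (hQ.conjTranspose_mul_mul_same hV).isUnit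
  rw [reducedPert, Matrix.mul_neg, mul_nonsing_inv_cancel_left _ _ hG]

theorem IsEigenbasis.galerkin_eq (h : IsEigenbasis F B Q V P Λ) (hQ : (toC Q).PosDef) :
    Vᴴ * (toC (F + N) + μ • toC Q) * V =
      (Vᴴ * toC Q * V) * (algebraMap ℂ _ μ - (diagonal Λ + reducedPert N Q V)) := by
  have hBt : Vᴴ * toC Bᵀ = 0 := by
    rw [show toC Bᵀ = (toC B)ᴴ by ext; simp [toC], ← conjTranspose_mul, h.divFree,
      conjTranspose_zero]
  have hF : Vᴴ * toC F * V = -((Vᴴ * toC Q * V) * diagonal Λ) := by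
    have hmom := congrArg (Vᴴ * ·) h.momentum
    simpa only [Matrix.mul_add, ← Matrix.mul_assoc, hBt, Matrix.zero_mul, add_zero,
      Matrix.mul_neg] using hmom
  have hFN : toC (F + N) = toC F + toC N := by ext; simp [toC]
  rw [hFN, Matrix.mul_sub, Matrix.mul_add (_ * _), mul_reducedPert hQ h.injective]
  simp only [Matrix.mul_add, Matrix.add_mul, hF, Algebra.algebraMap_eq_smul_one, Matrix.mul_smul,
    Matrix.smul_mul, Matrix.mul_one]
  abel

theorem IsEigenbasis.mem_spectrum_iff (h : IsEigenbasis F B Q V P Λ) (hQ : (toC Q).PosDef) :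
    μ ∈ spectrum ℂ (diagonal Λ + reducedPert N Q V) ↔
      ∃ (u : Fin nu → ℂ) (p : Fin np → ℂ), u ≠ 0 ∧
        toC (F + N) *ᵥ u + (toC B)ᴴ *ᵥ p = -(μ • (toC Q *ᵥ u)) ∧ toC B *ᵥ u = 0 := by
  have hG : (Vᴴ * toC Q * V).det ≠ 0 :=
    ((isUnit_iff_isUnit_det _).mp (hQ.conjTranspose_mul_mul_same h.injective).isUnit).ne_zero
  have hsing : μ ∈ spectrum ℂ (diagonal Λ + reducedPert N Q V) ↔
      ∃ a ≠ 0, Vᴴ *ᵥ (toC (F + N) *ᵥ (V *ᵥ a) + μ • (toC Q *ᵥ (V *ᵥ a))) = 0 := by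
    have hfact (a : Fin m → ℂ) : Vᴴ *ᵥ (toC (F + N) *ᵥ (V *ᵥ a) + μ • (toC Q *ᵥ (V *ᵥ a))) =
        (Vᴴ * (toC (F + N) + μ • toC Q) * V) *ᵥ a := by
      simp only [← mulVec_mulVec, add_mulVec, smul_mulVec]
    simp only [hfact, exists_mulVec_eq_zero_iff, h.galerkin_eq hQ, det_mul, mul_eq_zero, hG,
      false_or, spectrum.mem_iff, isUnit_iff_isUnit_det, isUnit_iff_ne_zero, not_not]
  rw [hsing]
  constructor
  · rintro ⟨a, ha, hVa⟩
    obtain ⟨p, hp⟩ := (exact_conjTranspose_mulVec h.exact _).mp hVa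
    refine ⟨V *ᵥ a, -p, fun hz => ha (h.injective (by simpa using hz)), ?_,
      h.exact.apply_apply_eq_zero a⟩
    rw [mulVec_neg, hp]
    abel
  · rintro ⟨u, p, hu, hmom, hdiv⟩
    obtain ⟨a, rfl⟩ := h.spans u hdiv
    refine ⟨a, fun ha => hu (by simp [ha]), (exact_conjTranspose_mulVec h.exact _).mpr ⟨-p, ?_⟩⟩
    rw [mulVec_neg, neg_eq_iff_add_eq_zero, add_comm, add_right_comm, hmom, neg_add_cancel]

theorem IsEigenbasis.spectrum_subset_genSpectrum (h : IsEigenbasis F B Q V P Λ)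
    (hQ : (toC Q).PosDef) : spectrum ℂ (diagonal Λ + reducedPert N Q V) ⊆
      genSpectrum (saddle (F + N) B) (massMat 0 Q B) := fun _ hμ => by
  obtain ⟨u, p, hu, hup⟩ := (h.mem_spectrum_iff hQ).mp hμ
  exact mem_genSpectrum_saddle_zero_iff.mpr ⟨u, p, Or.inl hu, hup⟩

theorem IsEigenbasis.exists_eq_of_isRightmost (h : IsEigenbasis F B Q V P Λ)
    (hQ : (toC Q).PosDef) (hμ : IsRightmost (genSpectrum (saddle F B) (massMat 0 Q B)) μ) :
    ∃ i, Λ i = μ := by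
  obtain ⟨u, p, hne, hmom, hdiv⟩ := mem_genSpectrum_saddle_zero_iff.mp hμ.1
  have hu : u ≠ 0 := by
    rintro rfl
    have hp : p = 0 := hμ.eq_zero_of_conjTranspose_mulVec_eq_zero (by simpa using hmom)
    simp [hp] at hne
  have hspec : μ ∈ spectrum ℂ (diagonal Λ + reducedPert 0 Q V) :=
    (h.mem_spectrum_iff hQ).mpr ⟨u, p, hu, by simpa using hmom, hdiv⟩
  simpa [reducedPert, toC] using hspec

theorem qNorm_nonneg (Q : Matrix (Fin nu) (Fin nu) ℝ) (z : Fin nu → ℂ) : 0 ≤ qNorm Q z :=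
  Real.sqrt_nonneg _

theorem qNorm_pos (hQ : (toC Q).PosDef) {z : Fin nu → ℂ} (hz : z ≠ 0) : 0 < qNorm Q z :=
  Real.sqrt_pos.mpr (Complex.pos_iff.mp (hQ.dotProduct_mulVec_pos hz)).1

theorem qNorm_sq (hQ : (toC Q).PosSemidef) (z : Fin nu → ℂ) :
    qNorm Q z ^ 2 = (star z ⬝ᵥ (toC Q *ᵥ z)).re :=
  Real.sq_sqrt (Complex.nonneg_iff.mp (hQ.dotProduct_mulVec_nonneg z)).1

theorem qNorm_smul (Q : Matrix (Fin nu) (Fin nu) ℝ) (c : ℝ) (z : Fin nu → ℂ) :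
    qNorm Q ((c : ℂ) • z) = |c| * qNorm Q z := by
  rw [qNorm, qNorm, ← Real.sqrt_sq_eq_abs, ← Real.sqrt_mul (sq_nonneg c)]
  congr 1
  simp only [mulVec_smul, star_smul, smul_dotProduct, dotProduct_smul]
  simp [sq, mul_assoc]

theorem CondLE.norm_mul_qNorm_le {κ : ℝ} (h : CondLE Q V κ) (a b : EuclideanSpace ℂ (Fin m)) :
    ‖b‖ * qNorm Q (V *ᵥ a) ≤ κ * (‖a‖ * qNorm Q (V *ᵥ b)) := by
  have hnorm : ∑ j, ‖((‖b‖ : ℂ) • a) j‖ ^ 2 = ∑ j, ‖((‖a‖ : ℂ) • b) j‖ ^ 2 := by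
    rw [← EuclideanSpace.norm_sq_eq, ← EuclideanSpace.norm_sq_eq, norm_smul, norm_smul]
    simp [mul_comm]
  have hab := h _ _ hnorm
  simp only [WithLp.ofLp_smul, mulVec_smul, qNorm_smul, abs_norm] at hab
  linarith

theorem CondLE.one_le {κ : ℝ} (h : CondLE Q V κ) (hQ : (toC Q).PosDef)
    (hV : Function.Injective V.mulVec) (i : Fin m) : 1 ≤ κ := by
  have hpos : 0 < qNorm Q (V *ᵥ Pi.single i 1) :=
    qNorm_pos hQ fun hz => by simpa using hV (hz.trans (mulVec_zero V).symm)
  exact (le_mul_iff_one_le_left hpos).mp (h _ _ rfl)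

theorem qNorm_mulVec_reducedPert_le (hQ : (toC Q).PosDef) (hV : Function.Injective V.mulVec)
    {η : ℝ} (hN : ∀ y x, ‖star y ⬝ᵥ (toC N *ᵥ x)‖ ≤ η * (qNorm Q y * qNorm Q x))
    {a : Fin m → ℂ} (ha : reducedPert N Q V *ᵥ a ≠ 0) :
    qNorm Q (V *ᵥ (reducedPert N Q V *ᵥ a)) ≤ η * qNorm Q (V *ᵥ a) := by
  set b := reducedPert N Q V *ᵥ a
  have hpos : 0 < qNorm Q (V *ᵥ b) := qNorm_pos hQ fun hz => ha (hV (hz.trans (mulVec_zero V).symm))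
  have hcongr (A : Matrix (Fin nu) (Fin nu) ℂ) (c : Fin m → ℂ) :
      star (V *ᵥ b) ⬝ᵥ (A *ᵥ (V *ᵥ c)) = star b ⬝ᵥ ((Vᴴ * A * V) *ᵥ c) := by
    rw [star_mulVec, ← dotProduct_mulVec, mulVec_mulVec, mulVec_mulVec, Matrix.mul_assoc]
  have hweak : star (V *ᵥ b) ⬝ᵥ (toC Q *ᵥ (V *ᵥ b)) =
      -(star (V *ᵥ b) ⬝ᵥ (toC N *ᵥ (V *ᵥ a))) := by
    rw [hcongr, hcongr, mulVec_mulVec, mul_reducedPert hQ hV, neg_mulVec, dotProduct_neg]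
  have hsq : qNorm Q (V *ᵥ b) * qNorm Q (V *ᵥ b) ≤ qNorm Q (V *ᵥ b) * (η * qNorm Q (V *ᵥ a)) :=
    calc qNorm Q (V *ᵥ b) * qNorm Q (V *ᵥ b)
        = (-(star (V *ᵥ b) ⬝ᵥ (toC N *ᵥ (V *ᵥ a)))).re := by
          rw [← sq, qNorm_sq hQ.posSemidef, hweak]
      _ ≤ ‖star (V *ᵥ b) ⬝ᵥ (toC N *ᵥ (V *ᵥ a))‖ := (Complex.re_le_norm _).trans_eq (norm_neg _)
      _ ≤ η * (qNorm Q (V *ᵥ b) * qNorm Q (V *ᵥ a)) := hN _ _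
      _ = _ := by ring
  exact le_of_mul_le_mul_left hsq hpos

theorem CondLE.norm_reducedPert_le {κ : ℝ} (h : CondLE Q V κ) (hκ : 0 ≤ κ) (hQ : (toC Q).PosDef)
    (hV : Function.Injective V.mulVec) {η : ℝ} (hη : 0 ≤ η)
    (hN : ∀ y x, ‖star y ⬝ᵥ (toC N *ᵥ x)‖ ≤ η * (qNorm Q y * qNorm Q x)) :
    ‖reducedPert N Q V‖ ≤ η * κ := by
  refine ContinuousLinearMap.opNorm_le_bound _ (mul_nonneg hη hκ) fun a => ?_
  rcases eq_or_ne (reducedPert N Q V *ᵥ a.ofLp) 0 with hb | hb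
  · have hzero : toEuclideanCLM (n := Fin m) (𝕜 := ℂ) (reducedPert N Q V) a = 0 :=
      WithLp.ofLp_injective 2 hb
    exact (norm_eq_zero.mpr hzero).trans_le (by positivity)
  have hpos : 0 < qNorm Q (V *ᵥ a.ofLp) := qNorm_pos hQ fun hz => hb (by
    rw [hV (hz.trans (mulVec_zero V).symm), mulVec_zero])
  refine le_of_mul_le_mul_right ?_ hpos
  calc _ ≤ κ * (‖a‖ * qNorm Q (V *ᵥ (reducedPert N Q V *ᵥ a.ofLp))) :=
        h.norm_mul_qNorm_le a (WithLp.toLp 2 (reducedPert N Q V *ᵥ a.ofLp))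
    _ ≤ κ * (‖a‖ * (η * qNorm Q (V *ᵥ a.ofLp))) := by
        gcongr
        exact qNorm_mulVec_reducedPert_le hQ hV hN hb
    _ = η * κ * ‖a‖ * qNorm Q (V *ᵥ a.ofLp) := by ring

theorem IsEigenbasis.exists_isClosest_saddle_add (h : IsEigenbasis F B Q V P Λ)
    (hQ : (toC Q).PosDef) (α : ℝ) (i : Fin m) :
    ∃ μ', IsClosest (genSpectrum (saddle (F + N) B) (massMat α Q B)) μ μ' := by
  have : Nonempty (Fin m) := ⟨i⟩
  obtain ⟨ζ, hζ⟩ := spectrum.nonempty_of_isAlgClosed_of_finiteDimensional ℂ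
    (diagonal Λ + reducedPert N Q V)
  exact exists_isClosest (isClosed_genSpectrum _ _)
    ⟨ζ, genSpectrum_massMat_zero_subset α (h.spectrum_subset_genSpectrum hQ hζ)⟩ μ

theorem IsEigenbasis.norm_sub_le_infDist (h : IsEigenbasis F B Q V P Λ) (hQ : (toC Q).PosDef)
    {α : ℝ} (i : Fin m) {μ' : ℂ}
    (hμ' : IsClosest (genSpectrum (saddle (F + N) B) (massMat α Q B)) μ μ') :
    ‖μ' - μ‖ ≤ Metric.infDist μ (spectrum ℂ (diagonal Λ + reducedPert N Q V)) := by
  have : Nonempty (Fin m) := ⟨i⟩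
  exact hμ'.norm_sub_le_infDist
    ((h.spectrum_subset_genSpectrum hQ).trans (genSpectrum_massMat_zero_subset α))
    (spectrum.nonempty_of_isAlgClosed_of_finiteDimensional ℂ _)

theorem IsEigenbasis.norm_sub_le_of_isClosest {η κ α : ℝ} (h : IsEigenbasis F B Q V P Λ)
    (hκ : CondLE Q V κ) (hQ : (toC Q).PosDef) (hη : 0 ≤ η)
    (hN : ∀ y x, ‖star y ⬝ᵥ (toC N *ᵥ x)‖ ≤ η * (qNorm Q y * qNorm Q x)) (i : Fin m) {μ' : ℂ}
    (hμ' : IsClosest (genSpectrum (saddle (F + N) B) (massMat α Q B)) (Λ i) μ') :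
    ‖μ' - Λ i‖ ≤ (2 * m - 1) * (η * κ) ∧
      ((∀ j, Λ j ≠ Λ i → 2 * (η * κ) < ‖Λ j - Λ i‖) → ‖μ' - Λ i‖ ≤ η * κ) := by
  have hκ₀ : 0 ≤ κ := zero_le_one.trans (hκ.one_le hQ h.injective i)
  have hE : ‖reducedPert N Q V‖ ≤ η * κ := hκ.norm_reducedPert_le hκ₀ hQ h.injective hη hN
  have hm : (1 : ℝ) ≤ m := by exact_mod_cast i.pos
  have hdist := h.norm_sub_le_infDist hQ i hμ'
  refine ⟨?_, fun hsep => ?_⟩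
  · calc _ ≤ _ := hdist
      _ ≤ (2 * m - 1) * ‖reducedPert N Q V‖ := by
        simpa using infDist_spectrum_diagonal_add_le Λ (reducedPert N Q V) i
      _ ≤ _ := mul_le_mul_of_nonneg_left hE (by linarith)
  · refine hdist.trans ((infDist_spectrum_diagonal_add_le_of_separated fun j hj => ?_).trans hE)
    exact (mul_le_mul_of_nonneg_left hE zero_le_two).trans_lt (hsep j hj)

end SaddlePoint

section Complexification

open Matrix
open scoped ComplexOrder

theorem star_dotProduct_toC_mulVec {m n : Type*} [Fintype m] [Fintype n] (A : Matrix m n ℝ)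
    (y : m → ℂ) (x : n → ℂ) :
    star y ⬝ᵥ (toC A *ᵥ x) =
      ⟨(fun i => (y i).re) ⬝ᵥ (A *ᵥ fun j => (x j).re) +
          (fun i => (y i).im) ⬝ᵥ (A *ᵥ fun j => (x j).im),
        (fun i => (y i).re) ⬝ᵥ (A *ᵥ fun j => (x j).im) -
          (fun i => (y i).im) ⬝ᵥ (A *ᵥ fun j => (x j).re)⟩ := by
  apply Complex.ext <;>
    simp [dotProduct, mulVec, toC, sub_eq_add_neg, Finset.sum_add_distrib]

theorem posDef_toC {n : Type*} [Finite n] {Q : Matrix n n ℝ} (hQ : Q.PosDef) :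
    (toC Q).PosDef := by
  have := Fintype.ofFinite n
  have hherm : (toC Q).IsHermitian := hQ.isHermitian.map _ fun x => (Complex.conj_ofReal x).symm
  refine .of_dotProduct_mulVec_pos hherm fun z hz => Complex.pos_iff.mpr
    ⟨?_, (hherm.im_star_dotProduct_mulVec_self z).symm⟩
  rw [star_dotProduct_toC_mulVec]
  rcases eq_or_ne (fun i => (z i).re) 0 with hre | hre
  · have him : (fun i => (z i).im) ≠ 0 := fun him =>
      hz (funext fun i => Complex.ext (congrFun hre i) (congrFun him i))
    simpa [hre] using hQ.dotProduct_mulVec_pos him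
  · exact add_pos_of_pos_of_nonneg (by simpa using hQ.dotProduct_mulVec_pos hre)
      (by simpa using hQ.posSemidef.dotProduct_mulVec_nonneg fun i => (z i).im)

variable {n : ℕ} {N Q : Matrix (Fin n) (Fin n) ℝ}

theorem sqrt_re_add_sqrt_im_le_qNorm (hQ : Q.PosSemidef) (z : Fin n → ℂ) :
    √((fun i => (z i).re) ⬝ᵥ (Q *ᵥ fun i => (z i).re)) +
      √((fun i => (z i).im) ⬝ᵥ (Q *ᵥ fun i => (z i).im)) ≤ √2 * qNorm Q z := by
  have hnonneg (a : Fin n → ℝ) : 0 ≤ a ⬝ᵥ (Q *ᵥ a) := by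
    simpa using hQ.dotProduct_mulVec_nonneg a
  rw [qNorm, star_dotProduct_toC_mulVec, ← Real.sqrt_mul zero_le_two]
  refine Real.le_sqrt_of_sq_le (add_sq_le.trans_eq ?_)
  rw [Real.sq_sqrt (hnonneg _), Real.sq_sqrt (hnonneg _)]

theorem norm_star_dotProduct_toC_mulVec_le (hQ : Q.PosSemidef) {K : ℝ} (hK : 0 ≤ K)
    (hN : ∀ a c : Fin n → ℝ, |a ⬝ᵥ (N *ᵥ c)| ≤ K * (√(a ⬝ᵥ (Q *ᵥ a)) * √(c ⬝ᵥ (Q *ᵥ c))))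
    (y x : Fin n → ℂ) :
    ‖star y ⬝ᵥ (toC N *ᵥ x)‖ ≤ 2 * K * (qNorm Q y * qNorm Q x) := by
  set a := fun i => (y i).re
  set b := fun i => (y i).im
  set c := fun i => (x i).re
  set d := fun i => (x i).im
  have hre : |a ⬝ᵥ (N *ᵥ c) + b ⬝ᵥ (N *ᵥ d)| ≤ _ :=
    (abs_add_le _ _).trans (add_le_add (hN a c) (hN b d))
  have him : |a ⬝ᵥ (N *ᵥ d) - b ⬝ᵥ (N *ᵥ c)| ≤ _ :=
    (abs_sub _ _).trans (add_le_add (hN a d) (hN b c))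
  calc ‖star y ⬝ᵥ (toC N *ᵥ x)‖
      ≤ |a ⬝ᵥ (N *ᵥ c) + b ⬝ᵥ (N *ᵥ d)| + |a ⬝ᵥ (N *ᵥ d) - b ⬝ᵥ (N *ᵥ c)| := by
        rw [star_dotProduct_toC_mulVec]
        exact Complex.norm_le_abs_re_add_abs_im _
    _ ≤ K * ((√(a ⬝ᵥ (Q *ᵥ a)) + √(b ⬝ᵥ (Q *ᵥ b))) *
        (√(c ⬝ᵥ (Q *ᵥ c)) + √(d ⬝ᵥ (Q *ᵥ d)))) := by linarith
    _ ≤ K * ((√2 * qNorm Q y) * (√2 * qNorm Q x)) := by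
        have := qNorm_nonneg Q y
        have hy := sqrt_re_add_sqrt_im_le_qNorm hQ y
        have hx := sqrt_re_add_sqrt_im_le_qNorm hQ x
        gcongr
    _ = K * (√2 * √2) * (qNorm Q y * qNorm Q x) := by ring
    _ = 2 * K * (qNorm Q y * qNorm Q x) := by rw [Real.mul_self_sqrt zero_le_two]; ring

end Complexification

section LTwo

/-- The `L²` norm of `f` on the set `s`; it is `0` when `‖f‖ ^ 2` is not integrable on `s`. -/
noncomputable def l2Norm {α F : Type*} [MeasureSpace α] [Norm F] (s : Set α) (f : α → F) : ℝ :=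
  √(∫ x in s, ‖f x‖ ^ 2)

/-- The linear map to `Lᵖ` induced by a linear family `f` of functions in `ℒᵖ`. -/
noncomputable def toLpMap {𝕜 α W F : Type*} [NormedField 𝕜] [MeasurableSpace α] {p : ENNReal}
    {μ : Measure α} [AddCommGroup W] [Module 𝕜 W] [NormedAddCommGroup F] [NormedSpace 𝕜 F]
    (f : W →ₗ[𝕜] α → F) (hf : ∀ w, MemLp (f w) p μ) : W →ₗ[𝕜] Lp F p μ where
  toFun w := (hf w).toLp (f w)
  map_add' u v := by
    rw [← MemLp.toLp_add]
    exact MemLp.toLp_congr _ _ (by rw [map_add])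
  map_smul' c w := by
    rw [RingHom.id_apply, ← MemLp.toLp_const_smul]
    exact MemLp.toLp_congr _ _ (by rw [map_smul])

theorem l2Norm_nonneg {α F : Type*} [MeasureSpace α] [Norm F] (s : Set α) (f : α → F) :
    0 ≤ l2Norm s f :=
  Real.sqrt_nonneg _

theorem l2Norm_sq {α F : Type*} [MeasureSpace α] [Norm F] (s : Set α) (f : α → F) :
    l2Norm s f ^ 2 = ∫ x in s, ‖f x‖ ^ 2 :=
  Real.sq_sqrt (integral_nonneg fun _ => sq_nonneg _)

theorem l2Norm_congr {α F : Type*} [MeasureSpace α] [Norm F] {s : Set α} (hs : MeasurableSet s)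
    {f g : α → F} (h : Set.EqOn f g s) : l2Norm s f = l2Norm s g := by
  rw [l2Norm, l2Norm, setIntegral_congr_fun hs (g := fun x => ‖g x‖ ^ 2) fun x hx => by
    simp only [h hx]]

theorem l2Norm_mono {α F G : Type*} [MeasureSpace α] [Norm F] [Norm G] {s t : Set α} {f : α → F}
    {g : α → G} (hst : s ⊆ t) (hg : IntegrableOn (fun x => ‖g x‖ ^ 2) t)
    (hfg : ∀ x, ‖f x‖ ^ 2 ≤ ‖g x‖ ^ 2) : l2Norm s f ≤ l2Norm t g :=
  Real.sqrt_le_sqrt <|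
    (integral_mono_of_nonneg (.of_forall fun _ => sq_nonneg _) (hg.mono_set hst)
      (.of_forall hfg)).trans
    (setIntegral_mono_set hg (.of_forall fun _ => sq_nonneg _) hst.eventuallyLE)

theorem sum_l2Norm_sq_le {α F ι : Type*} [MeasureSpace α] [Norm F] {I : Finset ι} {s : ι → Set α}
    {t : Set α} {f : α → F} (hs : ∀ i ∈ I, MeasurableSet (s i))
    (hdisj : (I : Set ι).PairwiseDisjoint s) (hst : ∀ i ∈ I, s i ⊆ t)
    (hf : IntegrableOn (fun x => ‖f x‖ ^ 2) t) :
    ∑ i ∈ I, l2Norm (s i) f ^ 2 ≤ l2Norm t f ^ 2 := by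
  simp only [l2Norm_sq]
  rw [← integral_biUnion_finset I hs hdisj fun i hi => hf.mono_set (hst i hi)]
  exact setIntegral_mono_set hf (.of_forall fun _ => sq_nonneg _)
    (Set.iUnion₂_subset hst).eventuallyLE

theorem memLp_of_continuousOn_isCompact {X F : Type*} [TopologicalSpace X] [MeasurableSpace X]
    [OpensMeasurableSpace X] {μ : Measure X} [IsFiniteMeasureOnCompacts μ] [NormedAddCommGroup F]
    [SecondCountableTopologyEither X F] {f : X → F} {K : Set X} {p : ENNReal} (hK : IsCompact K)
    (hKm : MeasurableSet K) (hf : ContinuousOn f K) : MemLp f p (μ.restrict K) := by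
  obtain ⟨M, hM⟩ := hK.exists_bound_of_continuousOn hf
  have : IsFiniteMeasure (μ.restrict K) := isFiniteMeasure_restrict.mpr hK.measure_lt_top.ne
  exact .of_bound (hf.aestronglyMeasurable_of_isCompact hK hKm) M
    ((ae_restrict_mem hKm).mono hM)

theorem inner_toLpMap {α W F : Type*} [MeasurableSpace α] {μ : Measure α} [AddCommGroup W]
    [Module ℝ W] [NormedAddCommGroup F] [InnerProductSpace ℝ F] (f : W →ₗ[ℝ] α → F)
    (hf : ∀ w, MemLp (f w) 2 μ) (u v : W) :
    inner ℝ (toLpMap f hf u) (toLpMap f hf v) = ∫ x, inner ℝ (f u x) (f v x) ∂μ := by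
  rw [L2.inner_def]
  refine integral_congr_ae ?_
  filter_upwards [(hf u).coeFn_toLp, (hf v).coeFn_toLp] with x hu hv
  exact congrArg₂ (inner ℝ) hu hv

theorem norm_toLpMap {α W F : Type*} [MeasureSpace α] {s : Set α} [AddCommGroup W] [Module ℝ W]
    [NormedAddCommGroup F] [InnerProductSpace ℝ F] (f : W →ₗ[ℝ] α → F)
    (hf : ∀ w, MemLp (f w) 2 (volume.restrict s)) (w : W) :
    ‖toLpMap f hf w‖ = l2Norm s (f w) := by
  rw [norm_eq_sqrt_real_inner, inner_toLpMap, l2Norm]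
  simp only [real_inner_self_eq_norm_sq]

theorem l2Norm_ball_comp_affine {E F : Type*} [NormedAddCommGroup E] [NormedSpace ℝ E]
    [FiniteDimensional ℝ E] [MeasureSpace E] [BorelSpace E] [(volume : Measure E).IsAddHaarMeasure]
    [Norm F] (f : E → F) (x₀ : E) {h : ℝ} (hh : 0 < h) (σ : ℝ) :
    l2Norm (Metric.ball 0 σ) (fun y => f (x₀ + h • y)) =
      (√(h ^ Module.finrank ℝ E))⁻¹ * l2Norm (Metric.ball x₀ (σ * h)) f := by
  rw [l2Norm, l2Norm, ← Real.sqrt_inv, ← Real.sqrt_mul (by positivity),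
    Measure.setIntegral_comp_smul_of_pos volume (fun y => ‖f (x₀ + y)‖ ^ 2) _ hh,
    smul_ball hh.ne', smul_zero, Real.norm_of_nonneg hh.le, smul_eq_mul,
    ← (measurePreserving_add_left volume x₀).setIntegral_preimage_emb
      (measurableEmbedding_addLeft x₀) fun x => ‖f x‖ ^ 2]
  simp [mul_comm]

end LTwo

section InverseEstimates

theorem exists_norm_le_mul_norm_of_injective {𝕜 X W E F : Type*} [NontriviallyNormedField 𝕜]
    [CompleteSpace 𝕜] [TopologicalSpace X] [AddCommGroup W] [Module 𝕜 W] [FiniteDimensional 𝕜 W]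
    [NormedAddCommGroup E] [NormedSpace 𝕜 E] [NormedAddCommGroup F] [NormedSpace 𝕜 F]
    {L : W →ₗ[𝕜] E} (hL : Function.Injective L) {T : X → W →ₗ[𝕜] F} {K : Set X}
    (hK : IsCompact K) (hT : ∀ w, ContinuousOn (fun x => T x w) K) :
    ∃ C > 0, ∀ x ∈ K, ∀ w, ‖T x w‖ ≤ C * ‖L w‖ := by
  have : CompactSpace K := isCompact_iff_compactSpace.mp hK
  let restrict : W →ₗ[𝕜] C(K, F) :=
    { toFun := fun w => ⟨fun x => T x w, continuousOn_iff_continuous_domRestrict.mp (hT w)⟩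
      map_add' := fun u v => ContinuousMap.ext fun x => map_add (T x) u v
      map_smul' := fun c w => ContinuousMap.ext fun x => map_smul (T x) c w }
  let A : L.range →L[𝕜] C(K, F) :=
    LinearMap.toContinuousLinearMap (restrict ∘ₗ (LinearEquiv.ofInjective L hL).symm.toLinearMap)
  refine ⟨‖A‖ + 1, by positivity, fun x hx w => ?_⟩
  have hA : A (LinearEquiv.ofInjective L hL w) = restrict w := by simp [A]
  calc ‖T x w‖ ≤ ‖A (LinearEquiv.ofInjective L hL w)‖ :=
        hA ▸ (restrict w).norm_coe_le_norm ⟨x, hx⟩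
    _ ≤ ‖A‖ * ‖L w‖ := A.le_opNorm _
    _ ≤ (‖A‖ + 1) * ‖L w‖ := by gcongr; linarith

variable {ι : Type*}

/-- The function on Euclidean space defined by a polynomial. -/
noncomputable def polyFun : MvPolynomial ι ℝ →ₐ[ℝ] (EuclideanSpace ℝ ι → ℝ) :=
  MvPolynomial.aeval fun i x => x i

theorem polyFun_apply (p : MvPolynomial ι ℝ) (x : EuclideanSpace ℝ ι) :
    polyFun p x = MvPolynomial.eval (fun i => x i) p := by
  induction p using MvPolynomial.induction_on with
  | C a => simp [polyFun]
  | add p q hp hq => simp [hp, hq]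
  | mul_X p i hp => rw [map_mul, map_mul, Pi.mul_apply, hp]; simp [polyFun]

theorem continuous_polyFun (p : MvPolynomial ι ℝ) : Continuous (polyFun p) := by
  simp only [funext (polyFun_apply p)]
  exact (MvPolynomial.continuous_eval p).comp (PiLp.continuous_ofLp 2 _)

theorem eq_zero_of_eqOn_polyFun_zero {p : MvPolynomial ι ℝ} {U : Set (EuclideanSpace ℝ ι)}
    (hU : IsOpen U) (hne : U.Nonempty) (h : Set.EqOn (polyFun p) 0 U) : p = 0 := by
  obtain ⟨x, hx⟩ := hne
  have hnhds : WithLp.toLp 2 ⁻¹' U ∈ nhds x.ofLp :=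
    (hU.preimage (PiLp.continuous_toLp 2 _)).mem_nhds hx
  rw [nhds_pi, Filter.mem_pi'] at hnhds
  obtain ⟨I, t, ht, hsub⟩ := hnhds
  refine MvPolynomial.funext_set t (fun i => infinite_of_mem_nhds _ (ht i)) fun y hy => ?_
  simpa [polyFun_apply] using h (hsub fun i _ => hy i trivial)

theorem exists_polyFun_comp_affine (p : MvPolynomial ι ℝ) (x₀ : EuclideanSpace ℝ ι) (h : ℝ) :
    ∃ q : MvPolynomial ι ℝ, q.totalDegree ≤ p.totalDegree ∧
      polyFun q = fun y => polyFun p (x₀ + h • y) := by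
  let f : ι → MvPolynomial ι ℝ := fun i =>
    MvPolynomial.C (x₀ i) + MvPolynomial.C h * MvPolynomial.X i
  have hf : ∀ i, (f i).totalDegree ≤ 1 := fun i => by
    refine (MvPolynomial.totalDegree_add _ _).trans (max_le (by simp) ?_)
    exact (MvPolynomial.totalDegree_mul _ _).trans (by simp)
  refine ⟨MvPolynomial.bind₁ f p, ?_, funext fun y => ?_⟩
  · rw [MvPolynomial.bind₁, MvPolynomial.aeval_def, MvPolynomial.eval₂_eq]
    refine MvPolynomial.totalDegree_finsetSum_le fun d hd => ?_
    refine (MvPolynomial.totalDegree_mul _ _).trans ?_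
    rw [MvPolynomial.algebraMap_eq, MvPolynomial.totalDegree_C, zero_add]
    refine (MvPolynomial.totalDegree_finsetProd _ _).trans ?_
    refine le_trans (Finset.sum_le_sum fun i _ => ?_) (MvPolynomial.le_totalDegree hd)
    exact (MvPolynomial.totalDegree_pow _ _).trans (by simpa using Nat.mul_le_mul_left (d i) (hf i))
  · rw [polyFun_apply, polyFun_apply, MvPolynomial.eval, MvPolynomial.eval₂Hom_bind₁]
    congr 2
    ext i
    simp [f]

variable [Fintype ι]

theorem contDiff_polyFun (p : MvPolynomial ι ℝ) {n : WithTop ℕ∞} : ContDiff ℝ n (polyFun p) := by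
  induction p using MvPolynomial.induction_on with
  | C a => rw [polyFun, MvPolynomial.aeval_C]; exact contDiff_const
  | add p q hp hq => rw [map_add]; exact hp.add hq
  | mul_X p i hp =>
    rw [map_mul, polyFun, MvPolynomial.aeval_X]
    exact hp.mul (by fun_prop)

theorem differentiableAt_polyFun {ι : Type*} [Finite ι] (p : MvPolynomial ι ℝ)
    (x : EuclideanSpace ℝ ι) : DifferentiableAt ℝ (polyFun p) x := by
  have := Fintype.ofFinite ι
  exact (contDiff_polyFun p).differentiable one_ne_zero x

theorem memLp_polyFun (p : MvPolynomial ι ℝ) {q : ENNReal} {s : Set (EuclideanSpace ℝ ι)}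
    (hs : Bornology.IsBounded s) : MemLp (polyFun p) q (volume.restrict s) := by
  have hclosure : MemLp (polyFun p) q (volume.restrict (closure s)) :=
    memLp_of_continuousOn_isCompact hs.isCompact_closure isClosed_closure.measurableSet
      (continuous_polyFun p).continuousOn
  exact hclosure.mono_measure (Measure.restrict_mono_set _ subset_closure)

theorem injective_toLpMap_polyFun {U : Set (EuclideanSpace ℝ ι)} (hU : IsOpen U)
    (hne : U.Nonempty) (hbdd : Bornology.IsBounded U) :
    Function.Injective (toLpMap (p := 2) (μ := volume.restrict U) polyFun.toLinearMap
      fun p => memLp_polyFun p hbdd) := by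
  rw [← LinearMap.ker_eq_bot, LinearMap.ker_eq_bot']
  intro p hp
  have hae : polyFun p =ᵐ[volume.restrict U] 0 :=
    (MemLp.toLp_eq_toLp_iff (memLp_polyFun p hbdd) MemLp.zero).mp hp
  exact eq_zero_of_eqOn_polyFun_zero hU hne (Measure.eqOn_open_of_ae_eq hae hU
    (continuous_polyFun p).continuousOn continuousOn_const)

/-- The value and the derivative of a polynomial at the point `y`, as a linear map; this is the
quantity that inverse estimates control by the `L²` norm. -/
noncomputable def polyJet (y : EuclideanSpace ℝ ι) :
    MvPolynomial ι ℝ →ₗ[ℝ] ℝ × (EuclideanSpace ℝ ι →L[ℝ] ℝ) where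
  toFun p := (polyFun p y, fderiv ℝ (polyFun p) y)
  map_add' p q := by
    rw [map_add, fderiv_add (differentiableAt_polyFun _ y) (differentiableAt_polyFun _ y),
      Pi.add_apply, Prod.mk_add_mk]
  map_smul' c p := by
    rw [map_smul, fderiv_const_smul (differentiableAt_polyFun _ y), Pi.smul_apply,
      RingHom.id_apply, Prod.smul_mk]

theorem continuous_polyJet (p : MvPolynomial ι ℝ) : Continuous fun y => polyJet y p :=
  (continuous_polyFun p).prodMk ((contDiff_polyFun p).continuous_fderiv one_ne_zero)

theorem exists_polyFun_le_l2Norm_unit (r : ℕ) {σ : ℝ} (hσ : 0 < σ) :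
    ∃ C > 0, ∀ p : MvPolynomial ι ℝ, p.totalDegree ≤ r → ∀ y ∈ Metric.closedBall 0 1,
      |polyFun p y| ≤ C * l2Norm (Metric.ball 0 σ) (polyFun p) ∧
        ‖fderiv ℝ (polyFun p) y‖ ≤ C * l2Norm (Metric.ball 0 σ) (polyFun p) := by
  let W := MvPolynomial.restrictTotalDegree ι ℝ r
  have hmem (p : W) : MemLp (polyFun p.1) 2 (volume.restrict (Metric.ball 0 σ)) :=
    memLp_polyFun p.1 Metric.isBounded_ball
  let L := toLpMap (polyFun.toLinearMap ∘ₗ W.subtype) hmem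
  have hinj : Function.Injective L :=
    (injective_toLpMap_polyFun Metric.isOpen_ball (Metric.nonempty_ball.mpr hσ)
      Metric.isBounded_ball).comp W.injective_subtype
  have hnorm (p : W) : ‖L p‖ = l2Norm (Metric.ball 0 σ) (polyFun p.1) := norm_toLpMap _ hmem p
  obtain ⟨C, hC, hbound⟩ := exists_norm_le_mul_norm_of_injective
    (T := fun y => polyJet y ∘ₗ W.subtype) hinj (isCompact_closedBall 0 1)
    fun p => (continuous_polyJet p.1).continuousOn
  refine ⟨C, hC, fun p hp y hy => ?_⟩
  have hjet : ‖polyJet y p‖ ≤ C * l2Norm (Metric.ball 0 σ) (polyFun p) := by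
    have := hbound y hy ⟨p, (MvPolynomial.mem_restrictTotalDegree _ _ _).mpr hp⟩
    rwa [hnorm] at this
  exact ⟨(norm_fst_le _).trans hjet, (norm_snd_le _).trans hjet⟩

theorem exists_polyFun_le_l2Norm (r : ℕ) {σ : ℝ} (hσ : 0 < σ) :
    ∃ C > 0, ∀ p : MvPolynomial ι ℝ, p.totalDegree ≤ r → ∀ (h : ℝ) (x₀ : EuclideanSpace ℝ ι),
      0 < h → ∀ y ∈ Metric.closedBall x₀ h,
        |polyFun p y| ≤
          C / √(h ^ Fintype.card ι) * l2Norm (Metric.ball x₀ (σ * h)) (polyFun p) ∧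
        ‖fderiv ℝ (polyFun p) y‖ ≤
          C / (h * √(h ^ Fintype.card ι)) * l2Norm (Metric.ball x₀ (σ * h)) (polyFun p) := by
  obtain ⟨C, hC, hunit⟩ := exists_polyFun_le_l2Norm_unit (ι := ι) r hσ
  refine ⟨C, hC, fun p hp h x₀ hh y hy => ?_⟩
  obtain ⟨q, hq, hpq⟩ := exists_polyFun_comp_affine p x₀ h
  obtain ⟨z, hz, rfl⟩ : ∃ z ∈ Metric.closedBall (0 : EuclideanSpace ℝ ι) 1, x₀ + h • z = y := by
    refine ⟨h⁻¹ • (y - x₀), ?_, by simp [smul_smul, hh.ne']⟩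
    rw [mem_closedBall_zero_iff, norm_smul, norm_inv, Real.norm_of_nonneg hh.le,
      inv_mul_le_one₀ hh]
    exact mem_closedBall_iff_norm.mp hy
  obtain ⟨hval, hder⟩ := hunit q (hq.trans hp) z hz
  have hfderiv : fderiv ℝ (polyFun q) z = h • fderiv ℝ (polyFun p) (x₀ + h • z) := by
    rw [hpq, fderiv_comp_smul (f := fun y => polyFun p (x₀ + y)), fderiv_comp_add_left]
  rw [hfderiv, norm_smul, Real.norm_of_nonneg hh.le] at hder
  rw [hpq, l2Norm_ball_comp_affine _ _ hh, finrank_euclideanSpace] at hval hder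
  constructor
  · exact hval.trans_eq (by rw [div_eq_mul_inv, mul_assoc])
  · rw [div_mul_eq_mul_div, le_div_iff₀ (by positivity)]
    rw [← div_eq_inv_mul, mul_div, le_div_iff₀ (by positivity)] at hder
    linarith

end InverseEstimates

section PolynomialsOnSets

/-- The function `u` agrees on `s` with a polynomial of total degree at most `r`. -/
def IsPolyOn {ι : Type*} (r : ℕ) (u : EuclideanSpace ℝ ι → ℝ) (s : Set (EuclideanSpace ℝ ι)) :
    Prop :=
  ∃ p : MvPolynomial ι ℝ, p.totalDegree ≤ r ∧ Set.EqOn u (polyFun p) s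

theorem IsPolyOn.contDiffOn {ι : Type*} [Fintype ι] {r : ℕ} {u : EuclideanSpace ℝ ι → ℝ}
    {s : Set (EuclideanSpace ℝ ι)} (hu : IsPolyOn r u s) {n : WithTop ℕ∞} :
    ContDiffOn ℝ n u s := by
  obtain ⟨p, -, hp⟩ := hu
  exact (contDiff_polyFun p).contDiffOn.congr hp

theorem IsFEFunction.isPolyOn {T : Finset Element} {r : ℕ} {u : Plane → ℝ}
    (hu : IsFEFunction T r u) {k : Element} (hk : k ∈ T) : IsPolyOn r u k.region := by
  obtain ⟨p, hp, h⟩ := hu k hk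
  exact ⟨p, hp, fun x hx => by rw [h x hx, polyFun_apply]⟩

theorem exists_isPolyOn_le_l2Norm (r : ℕ) {σ : ℝ} (hσ : 0 < σ) :
    ∃ C > 0, ∀ (s : Set Plane) (h : ℝ) (x₀ : Plane), Convex ℝ s → 0 < h →
      s ⊆ Metric.closedBall x₀ h → Metric.ball x₀ (σ * h) ⊆ s → ∀ u, IsPolyOn r u s → ∀ x ∈ s,
        |u x| ≤ C / h * l2Norm (Metric.ball x₀ (σ * h)) u ∧
        ‖fderivWithin ℝ u s x‖ ≤ C / h ^ 2 * l2Norm (Metric.ball x₀ (σ * h)) u := by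
  obtain ⟨C, hC, hinv⟩ := exists_polyFun_le_l2Norm (ι := Fin 2) r hσ
  refine ⟨C, hC, fun s h x₀ hconv hh hs hball u ⟨p, hp, hu⟩ x hx => ?_⟩
  have hunique : UniqueDiffWithinAt ℝ s x := uniqueDiffOn_convex hconv
    ⟨x₀, interior_maximal hball Metric.isOpen_ball (Metric.mem_ball_self (by positivity))⟩ x hx
  rw [fderivWithin_congr hu (hu hx),
    fderivWithin_eq_fderiv hunique (differentiableAt_polyFun p x), hu hx,
    l2Norm_congr Metric.isOpen_ball.measurableSet (hu.mono hball)]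
  have hroot : √(h ^ Fintype.card (Fin 2)) = h := Real.sqrt_sq hh.le
  simpa only [hroot, ← sq] using hinv p hp h x₀ hh x (hs hx)

end PolynomialsOnSets

namespace Element

theorem convex_region (k : Element) : Convex ℝ k.region := by
  cases k <;> exact convex_convexHull ℝ _

theorem isCompact_region (k : Element) : IsCompact k.region := by
  cases k <;> exact Set.Finite.isCompact_convexHull ℝ (Set.toFinite _)

theorem length_edges_le (k : Element) : k.edges.length ≤ 4 := by
  cases k <;> simp [edges]

theorem mem_region_of_mem_edges {k : Element} {e : Plane × Plane} (he : e ∈ k.edges) :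
    e.1 ∈ k.region ∧ e.2 ∈ k.region := by
  cases k with
  | triangle a b c _ =>
    have h : ({a, b, c} : Set Plane) ⊆ convexHull ℝ {a, b, c} := subset_convexHull ℝ _
    simp only [edges, List.mem_cons, List.not_mem_nil, or_false] at he
    rcases he with rfl | rfl | rfl <;> exact ⟨h (by simp), h (by simp)⟩
  | rectangle a e t _ _ =>
    have h : ({a, a + e, a + e + t • rotCCW e, a + t • rotCCW e} : Set Plane) ⊆ convexHull ℝ _ :=
      subset_convexHull ℝ _
    simp only [edges, List.mem_cons, List.not_mem_nil, or_false] at he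
    rcases he with rfl | rfl | rfl | rfl <;> exact ⟨h (by simp), h (by simp)⟩

theorem region_nonempty (k : Element) : k.region.Nonempty := by
  cases k <;> simp [region]

theorem region_subset_closedBall {k : Element} {h : ℝ} (hk : Metric.diam k.region ≤ h) {x₀ : Plane}
    (hx₀ : x₀ ∈ k.region) : k.region ⊆ Metric.closedBall x₀ h := fun _ hx =>
  (Metric.dist_le_diam_of_mem k.isCompact_region.isBounded hx hx₀).trans hk

theorem mapsTo_edge_region {k : Element} {e : Plane × Plane} (he : e ∈ k.edges) :
    Set.MapsTo (fun τ : ℝ => e.1 + τ • (e.2 - e.1)) (Set.Icc 0 1) k.region := fun _ hτ =>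
  k.convex_region.add_smul_sub_mem (mem_region_of_mem_edges he).1 (mem_region_of_mem_edges he).2 hτ

theorem intervalIntegrable_flux {k : Element} {g : Plane → Plane} (hg : ContinuousOn g k.region)
    {e : Plane × Plane} (he : e ∈ k.edges) :
    IntervalIntegrable (fun τ : ℝ => inner ℝ (g (e.1 + τ • (e.2 - e.1))) (rotCW (e.2 - e.1)))
      volume 0 1 := by
  refine ContinuousOn.intervalIntegrable_of_Icc zero_le_one ?_
  exact (hg.comp (by fun_prop) (mapsTo_edge_region he)).inner continuousOn_const

theorem boundaryFlux_add {k : Element} {f g : Plane → Plane} (hf : ContinuousOn f k.region)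
    (hg : ContinuousOn g k.region) :
    k.boundaryFlux (fun x => f x + g x) = k.boundaryFlux f + k.boundaryFlux g := by
  rw [boundaryFlux, boundaryFlux, boundaryFlux, ← List.sum_map_add]
  refine congrArg List.sum (List.map_congr_left fun e he => ?_)
  simp only [inner_add_left]
  exact intervalIntegral.integral_add (intervalIntegrable_flux hf he)
    (intervalIntegrable_flux hg he)

theorem boundaryFlux_smul (k : Element) (c : ℝ) (f : Plane → Plane) :
    k.boundaryFlux (fun x => c • f x) = c * k.boundaryFlux f := by
  rw [boundaryFlux, boundaryFlux, ← List.sum_map_mul_left]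
  refine congrArg List.sum (List.map_congr_left fun e _ => ?_)
  simp only [real_inner_smul_left]
  exact intervalIntegral.integral_const_mul _ _

theorem norm_rotCW (v : Plane) : ‖rotCW v‖ = ‖v‖ := by
  simp [rotCW, EuclideanSpace.norm_eq, Fin.sum_univ_two, add_comm]

theorem abs_edge_flux_le {k : Element} {g : Plane → Plane} {M : ℝ}
    (hg : ∀ x ∈ k.region, ‖g x‖ ≤ M) {e : Plane × Plane} (he : e ∈ k.edges) :
    |∫ τ in (0 : ℝ)..1, inner ℝ (g (e.1 + τ • (e.2 - e.1))) (rotCW (e.2 - e.1))| ≤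
      M * Metric.diam k.region := by
  have hM : 0 ≤ M := (norm_nonneg _).trans (hg _ (mem_region_of_mem_edges he).1)
  have hlength : ‖rotCW (e.2 - e.1)‖ ≤ Metric.diam k.region := by
    rw [norm_rotCW, ← dist_eq_norm]
    exact Metric.dist_le_diam_of_mem k.isCompact_region.isBounded
      (mem_region_of_mem_edges he).2 (mem_region_of_mem_edges he).1
  have hbound : ∀ τ ∈ Set.uIoc (0 : ℝ) 1, ‖(inner ℝ (g (e.1 + τ • (e.2 - e.1)))
      (rotCW (e.2 - e.1)) : ℝ)‖ ≤ M * Metric.diam k.region := by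
    rw [Set.uIoc_of_le zero_le_one]
    exact fun τ hτ => (norm_inner_le_norm _ _).trans (mul_le_mul
      (hg _ (mapsTo_edge_region he ⟨hτ.1.le, hτ.2⟩)) hlength (norm_nonneg _) hM)
  simpa using intervalIntegral.norm_integral_le_of_norm_le_const hbound

theorem abs_boundaryFlux_le {k : Element} {g : Plane → Plane} {M : ℝ}
    (hg : ∀ x ∈ k.region, ‖g x‖ ≤ M) :
    |k.boundaryFlux g| ≤ 4 * (M * Metric.diam k.region) := by
  obtain ⟨x, hx⟩ := k.region_nonempty
  have hM : 0 ≤ M := (norm_nonneg _).trans (hg x hx)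
  calc |k.boundaryFlux g| ≤ (k.edges.map fun e => |∫ τ in (0 : ℝ)..1,
          inner ℝ (g (e.1 + τ • (e.2 - e.1))) (rotCW (e.2 - e.1))|).sum := by
        rw [boundaryFlux, ← Function.comp_def abs, ← List.map_map]
        exact List.le_sum_of_subadditive abs abs_zero.le abs_add_le _
    _ ≤ k.edges.length • (M * Metric.diam k.region) := by
        simpa using List.sum_le_card_nsmul _ (M * Metric.diam k.region)
          (List.forall_mem_map.mpr fun e he => abs_edge_flux_le hg he)
    _ ≤ 4 * (M * Metric.diam k.region) := by
        rw [nsmul_eq_mul]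
        gcongr
        exact_mod_cast k.length_edges_le

end Element

namespace Discretization

variable {φ u u' v v' : Plane → ℝ} {k : Element}

theorem continuousOn_curlOn (hk : UniqueDiffOn ℝ k.region) (hφ : ContDiffOn ℝ 1 φ k.region) :
    ContinuousOn (curlOn φ k) k.region := by
  have hderiv := hφ.continuousOn_fderivWithin hk le_rfl
  refine (PiLp.continuous_toLp 2 _).comp_continuousOn (continuousOn_pi.mpr fun i => ?_)
  fin_cases i
  · exact (hderiv.clm_apply continuousOn_const).neg
  · exact hderiv.clm_apply continuousOn_const

theorem integrableOn_convection (hk : UniqueDiffOn ℝ k.region) (hφ : ContDiffOn ℝ 1 φ k.region)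
    (hu : ContDiffOn ℝ 1 u k.region) (hv : ContinuousOn v k.region) :
    IntegrableOn (fun x => fderivWithin ℝ u k.region x (curlOn φ k x) * v x) k.region :=
  (((hu.continuousOn_fderivWithin hk le_rfl).clm_apply (continuousOn_curlOn hk hφ)).mul
    hv).integrableOn_compact k.isCompact_region

theorem continuousOn_fluxDensity (hk : UniqueDiffOn ℝ k.region) (hφ : ContDiffOn ℝ 1 φ k.region)
    (hu : ContinuousOn u k.region) (hv : ContinuousOn v k.region) :
    ContinuousOn (fun x => (u x * v x) • curlOn φ k x) k.region :=
  (hu.mul hv).smul (continuousOn_curlOn hk hφ)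

theorem cElement_add_left (hk : UniqueDiffOn ℝ k.region) (hφ : ContDiffOn ℝ 1 φ k.region)
    (hu : ContDiffOn ℝ 1 u k.region) (hu' : ContDiffOn ℝ 1 u' k.region)
    (hv : ContinuousOn v k.region) :
    cElement φ k (u + u') v = cElement φ k u v + cElement φ k u' v := by
  have hconv : ∫ x in k.region, fderivWithin ℝ (u + u') k.region x (curlOn φ k x) * v x =
      (∫ x in k.region, fderivWithin ℝ u k.region x (curlOn φ k x) * v x) +
        ∫ x in k.region, fderivWithin ℝ u' k.region x (curlOn φ k x) * v x := by
    rw [← integral_add (integrableOn_convection hk hφ hu hv)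
      (integrableOn_convection hk hφ hu' hv)]
    refine setIntegral_congr_fun k.isCompact_region.measurableSet fun x hx => ?_
    simp only [fderivWithin_add (hk x hx) (hu.differentiableOn one_ne_zero x hx)
      (hu'.differentiableOn one_ne_zero x hx), add_apply, add_mul]
  have hflux := Element.boundaryFlux_add (continuousOn_fluxDensity hk hφ hu.continuousOn hv)
    (continuousOn_fluxDensity hk hφ hu'.continuousOn hv)
  simp only [cElement, hconv, Pi.add_apply, add_mul, add_smul, hflux]
  ring

theorem cElement_smul_left (hk : UniqueDiffOn ℝ k.region) (c : ℝ) :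
    cElement φ k (c • u) v = c * cElement φ k u v := by
  have hconv : ∫ x in k.region, fderivWithin ℝ (c • u) k.region x (curlOn φ k x) * v x =
      c * ∫ x in k.region, fderivWithin ℝ u k.region x (curlOn φ k x) * v x := by
    rw [← integral_const_mul]
    refine setIntegral_congr_fun k.isCompact_region.measurableSet fun x hx => ?_
    simp only [fderivWithin_const_smul_field c (hk x hx),
      smul_apply, smul_eq_mul, mul_assoc]
  have hflux := k.boundaryFlux_smul c fun x => (u x * v x) • curlOn φ k x
  simp only [cElement, hconv, Pi.smul_apply, smul_eq_mul, mul_assoc, mul_smul c] at hflux ⊢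
  rw [hflux]
  ring

theorem cElement_add_right (hk : UniqueDiffOn ℝ k.region) (hφ : ContDiffOn ℝ 1 φ k.region)
    (hu : ContDiffOn ℝ 1 u k.region) (hv : ContinuousOn v k.region)
    (hv' : ContinuousOn v' k.region) :
    cElement φ k u (v + v') = cElement φ k u v + cElement φ k u v' := by
  simp only [cElement, Pi.add_apply, mul_add, add_smul]
  rw [integral_add (integrableOn_convection hk hφ hu hv) (integrableOn_convection hk hφ hu hv'),
    Element.boundaryFlux_add (continuousOn_fluxDensity hk hφ hu.continuousOn hv)
      (continuousOn_fluxDensity hk hφ hu.continuousOn hv')]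
  ring

theorem cElement_smul_right (c : ℝ) : cElement φ k u (c • v) = c * cElement φ k u v := by
  simp only [cElement, Pi.smul_apply, smul_eq_mul, mul_left_comm _ c, mul_smul c]
  rw [integral_const_mul, k.boundaryFlux_smul]
  ring

theorem abs_cElement_le {A A' B M : ℝ} (hu : ∀ x ∈ k.region, |u x| ≤ A)
    (hu' : ∀ x ∈ k.region, ‖fderivWithin ℝ u k.region x‖ ≤ A') (hv : ∀ x ∈ k.region, |v x| ≤ B)
    (hM : ∀ x ∈ k.region, ‖curlOn φ k x‖ ≤ M) :
    |cElement φ k u v| ≤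
      A' * M * B * volume.real k.region + 2 * (A * B * M * Metric.diam k.region) := by
  obtain ⟨x₀, hx₀⟩ := k.region_nonempty
  have hA : 0 ≤ A := (abs_nonneg _).trans (hu x₀ hx₀)
  have hA' : 0 ≤ A' := (norm_nonneg _).trans (hu' x₀ hx₀)
  have hB : 0 ≤ B := (abs_nonneg _).trans (hv x₀ hx₀)
  have hM0 : 0 ≤ M := (norm_nonneg _).trans (hM x₀ hx₀)
  have hconv : |∫ x in k.region, fderivWithin ℝ u k.region x (curlOn φ k x) * v x| ≤
      A' * M * B * volume.real k.region := by
    rw [← Real.norm_eq_abs]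
    refine norm_setIntegral_le_of_norm_le_const k.isCompact_region.measure_lt_top fun x hx => ?_
    rw [norm_mul]
    exact mul_le_mul (ContinuousLinearMap.le_of_opNorm_le_of_le _ (hu' x hx) (hM x hx)) (hv x hx)
      (norm_nonneg _) (by positivity)
  have hflux : |k.boundaryFlux fun x => (u x * v x) • curlOn φ k x| ≤
      4 * (A * B * M * Metric.diam k.region) :=
    Element.abs_boundaryFlux_le fun x hx => by
      rw [norm_smul, norm_mul]
      exact mul_le_mul (mul_le_mul (hu x hx) (hv x hx) (norm_nonneg _) hA) (hM x hx)
        (norm_nonneg _) (by positivity)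
  calc |cElement φ k u v| ≤ _ := abs_sub _ _
    _ ≤ _ := by
        rw [abs_mul, abs_of_pos (one_half_pos (α := ℝ))]
        linarith

theorem exists_abs_cElement_le_l2Norm (r : ℕ) {σ : ℝ} (hσ : 0 < σ) :
    ∃ C > 0, ∀ (k : Element) (h : ℝ) (x₀ : Plane), 0 < h → Metric.diam k.region ≤ h →
      Metric.ball x₀ (σ * h) ⊆ k.region → ∀ u v, IsPolyOn r u k.region → IsPolyOn r v k.region →
      ∀ (φ : Plane → ℝ) (M : ℝ), (∀ x ∈ k.region, ‖curlOn φ k x‖ ≤ M) →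
        |cElement φ k u v| ≤ C / h * M *
          (l2Norm (Metric.ball x₀ (σ * h)) u * l2Norm (Metric.ball x₀ (σ * h)) v) := by
  obtain ⟨c, hc, hinv⟩ := exists_isPolyOn_le_l2Norm r hσ
  set ω := volume.real (Metric.ball (0 : Plane) 1)
  refine ⟨c ^ 2 * (ω + 2), by positivity, fun k h x₀ hh hdiam hball u v hu hv φ M hM => ?_⟩
  have hx₀ : x₀ ∈ k.region := hball (Metric.mem_ball_self (by positivity))
  have hM0 : 0 ≤ M := (norm_nonneg _).trans (hM x₀ hx₀)
  have hsub : k.region ⊆ Metric.closedBall x₀ h := Element.region_subset_closedBall hdiam hx₀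
  have hvol : volume.real k.region ≤ h ^ 2 * ω := by
    refine (measureReal_mono hsub measure_closedBall_lt_top.ne).trans_eq ?_
    rw [Measure.addHaar_real_closedBall _ _ hh.le, finrank_euclideanSpace_fin]
  have hinv' := hinv k.region h x₀ k.convex_region hh hsub hball
  set a := l2Norm (Metric.ball x₀ (σ * h)) u
  set b := l2Norm (Metric.ball x₀ (σ * h)) v
  have ha : 0 ≤ a := l2Norm_nonneg _ _
  have hb : 0 ≤ b := l2Norm_nonneg _ _
  calc |cElement φ k u v|
      ≤ c / h ^ 2 * a * M * (c / h * b) * volume.real k.region +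
          2 * (c / h * a * (c / h * b) * M * Metric.diam k.region) :=
        abs_cElement_le (fun x hx => (hinv' u hu x hx).1) (fun x hx => (hinv' u hu x hx).2)
          (fun x hx => (hinv' v hv x hx).1) hM
    _ ≤ c / h ^ 2 * a * M * (c / h * b) * (h ^ 2 * ω) +
          2 * (c / h * a * (c / h * b) * M * h) := by gcongr
    _ = c ^ 2 * (ω + 2) / h * M * (a * b) := by field_simp

end Discretization

namespace Discretization

open Matrix

variable {r nu : ℕ} {D : Discretization r} {σ h : ℝ} {φ : Plane → ℝ} {k : Element}

theorem QuasiUniform.uniqueDiffOn_region (hq : D.QuasiUniform σ h) (hσ : 0 < σ) (hh : 0 < h)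
    (hk : k ∈ D.mesh) : UniqueDiffOn ℝ k.region := by
  obtain ⟨-, x₀, hball⟩ := hq k hk
  exact uniqueDiffOn_convex k.convex_region
    ⟨x₀, interior_maximal hball Metric.isOpen_ball (Metric.mem_ball_self (by positivity))⟩

theorem ball_subset_dom {x₀ : Plane} {ρ : ℝ} (hk : k ∈ D.mesh)
    (hball : Metric.ball x₀ ρ ⊆ k.region) : Metric.ball x₀ ρ ⊆ D.dom :=
  interior_maximal (hball.trans (Set.subset_biUnion_of_mem (u := Element.region) hk))
    Metric.isOpen_ball

theorem isPolyOn_of_mem_X {u : Plane → Plane} (hu : u ∈ D.X) (hk : k ∈ D.mesh) (i : Fin 2) :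
    IsPolyOn r (fun x => u x i) k.region :=
  (D.X_fe u hu i).isPolyOn hk

theorem continuousOn_of_mem_X {u : Plane → Plane} (hu : u ∈ D.X) :
    ContinuousOn u (cover D.mesh) := by
  rw [cover, ← Finset.set_biUnion_coe, Set.biUnion_eq_iUnion]
  refine (locallyFinite_of_finite _).continuousOn_iUnion
    (fun k => k.1.isCompact_region.isClosed) fun k => ?_
  exact (PiLp.continuous_toLp 2 _).comp_continuousOn <| continuousOn_pi.mpr fun i =>
    (isPolyOn_of_mem_X hu k.2 i).contDiffOn (n := 0).continuousOn

theorem memLp_of_mem_X {u : Plane → Plane} (hu : u ∈ D.X) :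
    MemLp u 2 (volume.restrict D.dom) := by
  have hcover : IsCompact (cover D.mesh) :=
    D.mesh.finite_toSet.isCompact_biUnion fun k _ => k.isCompact_region
  exact (memLp_of_continuousOn_isCompact hcover hcover.measurableSet
    (continuousOn_of_mem_X hu)).mono_measure (Measure.restrict_mono_set _ interior_subset)

theorem integrableOn_norm_sq_of_mem_X {u : Plane → Plane} (hu : u ∈ D.X) :
    IntegrableOn (fun x => ‖u x‖ ^ 2) D.dom :=
  (memLp_two_iff_integrable_sq_norm (memLp_of_mem_X hu).1).mp (memLp_of_mem_X hu)

theorem l2Norm_apply_le {u : Plane → Plane} (hu : u ∈ D.X) {s t : Set Plane} (hst : s ⊆ t)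
    (ht : t ⊆ D.dom) (i : Fin 2) : l2Norm s (fun x => u x i) ≤ l2Norm t u :=
  l2Norm_mono hst ((integrableOn_norm_sq_of_mem_X hu).mono_set ht) fun x => by
    gcongr
    exact PiLp.norm_apply_le _ i

theorem eq_zero_of_l2Norm_eq_zero (hq : D.QuasiUniform σ h) (hσ : 0 < σ) (hh : 0 < h)
    {u : Plane → Plane} (hu : u ∈ D.X) (hu0 : l2Norm D.dom u = 0) : u = 0 := by
  obtain ⟨C, hC, hinv⟩ := exists_isPolyOn_le_l2Norm r hσ
  ext x i
  by_cases hx : x ∈ cover D.mesh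
  · obtain ⟨k, hk, hxk⟩ := Set.mem_iUnion₂.mp hx
    obtain ⟨hdiam, x₀, hball⟩ := hq k hk
    have hsub : k.region ⊆ Metric.closedBall x₀ h :=
      Element.region_subset_closedBall hdiam (hball (Metric.mem_ball_self (by positivity)))
    have hval := (hinv k.region h x₀ k.convex_region hh hsub hball _
      (isPolyOn_of_mem_X hu hk i) x hxk).1
    have hzero : l2Norm (Metric.ball x₀ (σ * h)) (fun x => u x i) ≤ 0 :=
      hu0 ▸ l2Norm_apply_le hu (ball_subset_dom hk hball) subset_rfl i
    exact abs_nonpos_iff.mp (hval.trans (mul_nonpos_of_nonneg_of_nonpos (by positivity) hzero))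
  · rw [D.X_support u hu x hx]
    rfl

theorem QuasiUniform.norm_curlOn_le_deltaSup (hq : D.QuasiUniform σ h) (hσ : 0 < σ) (hh : 0 < h)
    (hφ : ∀ k ∈ D.mesh, ContDiffOn ℝ 1 φ k.region) (hk : k ∈ D.mesh) {x : Plane}
    (hx : x ∈ k.region) : ‖curlOn φ k x‖ ≤ D.deltaSup φ := by
  refine le_csSup ?_ ⟨k, hk, x, hx, rfl⟩
  have hset : {y | ∃ k ∈ D.mesh, ∃ x ∈ k.region, y = ‖curlOn φ k x‖} =
      ⋃ k ∈ D.mesh, (fun x => ‖curlOn φ k x‖) '' k.region := by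
    ext y
    simp [eq_comm]
  rw [hset]
  refine (Set.Finite.bddAbove_biUnion D.mesh.finite_toSet).mpr fun k hk => ?_
  exact k.isCompact_region.bddAbove_image
    (continuousOn_curlOn (hq.uniqueDiffOn_region hσ hh hk) (hφ k hk)).norm

theorem deltaSup_nonneg (D : Discretization r) (φ : Plane → ℝ) : 0 ≤ D.deltaSup φ :=
  Real.sSup_nonneg <| by
    rintro _ ⟨k, -, x, -, rfl⟩
    exact norm_nonneg _

theorem sum_l2Norm_mul_l2Norm_ball_le {u v : Plane → Plane} (hu : u ∈ D.X) (hv : v ∈ D.X)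
    {x₀ : Element → Plane} {ρ : ℝ} (hball : ∀ k ∈ D.mesh, Metric.ball (x₀ k) ρ ⊆ k.region) :
    ∑ k ∈ D.mesh, l2Norm (Metric.ball (x₀ k) ρ) u * l2Norm (Metric.ball (x₀ k) ρ) v ≤
      l2Norm D.dom u * l2Norm D.dom v := by
  have hdisj : (D.mesh : Set Element).PairwiseDisjoint fun k => Metric.ball (x₀ k) ρ :=
    fun k hk l hl hkl => (D.mesh_disjoint k hk l hl hkl).mono
      (interior_maximal (hball k hk) Metric.isOpen_ball)
      (interior_maximal (hball l hl) Metric.isOpen_ball)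
  have hsum {w : Plane → Plane} (hw : w ∈ D.X) :
      √(∑ k ∈ D.mesh, l2Norm (Metric.ball (x₀ k) ρ) w ^ 2) ≤ l2Norm D.dom w :=
    Real.sqrt_le_iff.mpr ⟨l2Norm_nonneg _ _,
      sum_l2Norm_sq_le (fun _ _ => Metric.isOpen_ball.measurableSet) hdisj
        (fun k hk => ball_subset_dom hk (hball k hk)) (integrableOn_norm_sq_of_mem_X hw)⟩
  exact (Real.sum_mul_le_sqrt_mul_sqrt _ _ _).trans
    (mul_le_mul (hsum hu) (hsum hv) (Real.sqrt_nonneg _) (l2Norm_nonneg _ _))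

theorem exists_abs_cForm_le_l2Norm (r : ℕ) {σ : ℝ} (hσ : 0 < σ) :
    ∃ C > 0, ∀ (D : Discretization r) (h : ℝ), 0 < h → D.QuasiUniform σ h →
      ∀ u ∈ D.X, ∀ v ∈ D.X, ∀ (φ : Plane → ℝ) (M : ℝ), 0 ≤ M →
      (∀ k ∈ D.mesh, ∀ x ∈ k.region, ‖curlOn φ k x‖ ≤ M) →
        |D.cForm φ u v| ≤ C / h * M * (l2Norm D.dom u * l2Norm D.dom v) := by
  obtain ⟨C, hC, helement⟩ := exists_abs_cElement_le_l2Norm r hσ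
  refine ⟨2 * C, by positivity, fun D h hh hq u hu v hv φ M hM hcurl => ?_⟩
  choose! hdiam x₀ hball using hq
  have hcomp : ∀ k ∈ D.mesh, ∀ i, |cElement φ k (fun x => u x i) (fun x => v x i)| ≤
      C / h * M * (l2Norm (Metric.ball (x₀ k) (σ * h)) u *
        l2Norm (Metric.ball (x₀ k) (σ * h)) v) := fun k hk i => by
    refine (helement k h (x₀ k) hh (hdiam k hk) (hball k hk) _ _ (isPolyOn_of_mem_X hu hk i)
      (isPolyOn_of_mem_X hv hk i) φ M (hcurl k hk)).trans ?_
    gcongr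
    · exact l2Norm_nonneg _ _
    · exact l2Norm_nonneg _ _
    · exact l2Norm_apply_le hu subset_rfl (ball_subset_dom hk (hball k hk)) i
    · exact l2Norm_apply_le hv subset_rfl (ball_subset_dom hk (hball k hk)) i
  calc |D.cForm φ u v|
      ≤ ∑ k ∈ D.mesh, ∑ i, |cElement φ k (fun x => u x i) (fun x => v x i)| :=
        (Finset.abs_sum_le_sum_abs _ _).trans
          (Finset.sum_le_sum fun _ _ => Finset.abs_sum_le_sum_abs _ _)
    _ ≤ ∑ k ∈ D.mesh, ∑ _i : Fin 2, C / h * M * (l2Norm (Metric.ball (x₀ k) (σ * h)) u *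
          l2Norm (Metric.ball (x₀ k) (σ * h)) v) :=
        Finset.sum_le_sum fun k hk => Finset.sum_le_sum fun i _ => hcomp k hk i
    _ = 2 * C / h * M * ∑ k ∈ D.mesh, l2Norm (Metric.ball (x₀ k) (σ * h)) u *
          l2Norm (Metric.ball (x₀ k) (σ * h)) v := by
        rw [Finset.mul_sum]
        refine Finset.sum_congr rfl fun k _ => ?_
        rw [Fin.sum_univ_two]
        ring
    _ ≤ 2 * C / h * M * (l2Norm D.dom u * l2Norm D.dom v) := by
        gcongr
        exact sum_l2Norm_mul_l2Norm_ball_le hu hv hball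

/-- The perturbation form `c_h` on the velocity space as a bilinear form. -/
noncomputable def cBilin (hD : ∀ k ∈ D.mesh, UniqueDiffOn ℝ k.region)
    (hφ : ∀ k ∈ D.mesh, ContDiffOn ℝ 1 φ k.region) : LinearMap.BilinForm ℝ D.X0 :=
  have hreg (u : D.X0) {k : Element} (hk : k ∈ D.mesh) (i : Fin 2) {n : WithTop ℕ∞} :
      ContDiffOn ℝ n (fun x => u.1 x i) k.region := (isPolyOn_of_mem_X u.2.1 hk i).contDiffOn
  LinearMap.mk₂ ℝ (fun u v => D.cForm φ u v)
    (fun u u' v => by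
      simp only [cForm, ← Finset.sum_add_distrib]
      exact Finset.sum_congr rfl fun k hk => Finset.sum_congr rfl fun i _ =>
        cElement_add_left (hD k hk) (hφ k hk) (hreg u hk i) (hreg u' hk i)
          (hreg v hk i (n := 0)).continuousOn)
    (fun c u v => by
      simp only [cForm, smul_eq_mul, Finset.mul_sum]
      exact Finset.sum_congr rfl fun k hk => Finset.sum_congr rfl fun i _ =>
        cElement_smul_left (hD k hk) c)
    (fun u v v' => by
      simp only [cForm, ← Finset.sum_add_distrib]
      exact Finset.sum_congr rfl fun k hk => Finset.sum_congr rfl fun i _ =>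
        cElement_add_right (hD k hk) (hφ k hk) (hreg u hk i)
          (hreg v hk i (n := 0)).continuousOn (hreg v' hk i (n := 0)).continuousOn)
    (fun c u v => by
      simp only [cForm, smul_eq_mul, Finset.mul_sum]
      exact Finset.sum_congr rfl fun _ _ => Finset.sum_congr rfl fun _ _ =>
        cElement_smul_right c)

theorem dotProduct_matN_mulVec (hD : ∀ k ∈ D.mesh, UniqueDiffOn ℝ k.region)
    (hφ : ∀ k ∈ D.mesh, ContDiffOn ℝ 1 φ k.region) (e : Module.Basis (Fin nu) ℝ D.X0)
    (a c : Fin nu → ℝ) :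
    a ⬝ᵥ (D.matN φ e *ᵥ c) = D.cForm φ (e.equivFun.symm a) (e.equivFun.symm c) := by
  have hmat : D.matN φ e = LinearMap.BilinForm.toMatrix e (cBilin hD hφ) := by
    ext i j
    rw [LinearMap.BilinForm.toMatrix_apply]
    rfl
  rw [hmat, LinearMap.BilinForm.dotProduct_toMatrix_mulVec]
  rfl

/-- The velocity space as a space of `L²` functions, whose inner products make up `matQ`. -/
noncomputable def toL2 (D : Discretization r) : D.X0 →ₗ[ℝ] Lp Plane 2 (volume.restrict D.dom) :=
  toLpMap D.X0.subtype fun u => memLp_of_mem_X u.2.1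

theorem norm_toL2 (u : D.X0) : ‖D.toL2 u‖ = l2Norm D.dom u.1 :=
  norm_toLpMap _ _ u

theorem matQ_eq_gram (e : Module.Basis (Fin nu) ℝ D.X0) :
    D.matQ e = Matrix.gram ℝ fun i => D.toL2 (e i) := by
  ext i j
  exact (inner_toLpMap D.X0.subtype (fun u => memLp_of_mem_X u.2.1) (e i) (e j)).symm

theorem posDef_matQ (hq : D.QuasiUniform σ h) (hσ : 0 < σ) (hh : 0 < h)
    (e : Module.Basis (Fin nu) ℝ D.X0) : (D.matQ e).PosDef := by
  have hker : LinearMap.ker D.toL2 = ⊥ := LinearMap.ker_eq_bot'.mpr fun u hu =>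
    Subtype.ext (eq_zero_of_l2Norm_eq_zero hq hσ hh u.2.1 (by rw [← norm_toL2, hu, norm_zero]))
  rw [matQ_eq_gram]
  exact Matrix.posDef_gram_of_linearIndependent (e.linearIndependent.map' _ hker)

theorem sqrt_dotProduct_matQ_mulVec (e : Module.Basis (Fin nu) ℝ D.X0) (a : Fin nu → ℝ) :
    √(a ⬝ᵥ (D.matQ e *ᵥ a)) = l2Norm D.dom (e.equivFun.symm a).1 := by
  have hgram := Matrix.star_dotProduct_gram_mulVec (𝕜 := ℝ) (fun i => D.toL2 (e i)) a a
  rw [star_trivial] at hgram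
  rw [matQ_eq_gram, hgram, ← norm_eq_sqrt_real_inner,
    ← norm_toL2, e.equivFun_symm_apply, map_sum]
  simp only [map_smul]

theorem exists_abs_dotProduct_matN_mulVec_le (r : ℕ) {σ : ℝ} (hσ : 0 < σ) :
    ∃ C > 0, ∀ (D : Discretization r) (h : ℝ), 0 < h → D.QuasiUniform σ h →
      ∀ (nu : ℕ) (e : Module.Basis (Fin nu) ℝ D.X0) (φ : Plane → ℝ) (s : ℕ),
      IsFEFunction D.mesh s φ → ∀ a c : Fin nu → ℝ, |a ⬝ᵥ (D.matN φ e *ᵥ c)| ≤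
        C / h * D.deltaSup φ * (√(a ⬝ᵥ (D.matQ e *ᵥ a)) * √(c ⬝ᵥ (D.matQ e *ᵥ c))) := by
  obtain ⟨C, hC, hbound⟩ := exists_abs_cForm_le_l2Norm r hσ
  refine ⟨C, hC, fun D h hh hq nu e φ s hφ a c => ?_⟩
  have hsmooth (k : Element) (hk : k ∈ D.mesh) : ContDiffOn ℝ 1 φ k.region :=
    (hφ.isPolyOn hk).contDiffOn
  rw [dotProduct_matN_mulVec (fun k hk => hq.uniqueDiffOn_region hσ hh hk) hsmooth,
    sqrt_dotProduct_matQ_mulVec, sqrt_dotProduct_matQ_mulVec]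
  exact hbound D h hh hq _ (e.equivFun.symm a).2.1 _ (e.equivFun.symm c).2.1 φ _
    (D.deltaSup_nonneg φ) fun k hk x hx => hq.norm_curlOn_le_deltaSup hσ hh hsmooth hk hx

end Discretization

end NSPerturb

theorem mainTheorem1_general (r : ℕ) {σ : ℝ} (hσ : 0 < σ) :
    ∃ C : ℝ, 0 < C ∧
      ∀ (D : NSPerturb.Discretization r) (h : ℝ), 0 < h → D.QuasiUniform σ h →
      ∀ (nu np m : ℕ) (e : Module.Basis (Fin nu) ℝ D.X0)
        (F : Matrix (Fin nu) (Fin nu) ℝ) (B : Matrix (Fin np) (Fin nu) ℝ)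
        (V : Matrix (Fin nu) (Fin m) ℂ) (P : Matrix (Fin np) (Fin m) ℂ) (Λ : Fin m → ℂ) (κ : ℝ),
        NSPerturb.IsEigenbasis F B (D.matQ e) V P Λ → NSPerturb.CondLE (D.matQ e) V κ →
      ∀ (i : Fin m) (φ : NSPerturb.Plane → ℝ) (s : ℕ), NSPerturb.IsFEFunction D.mesh s φ →
      ∀ (α : ℝ) (S : Set ℂ),
        S = NSPerturb.genSpectrum (NSPerturb.saddle (F + D.matN φ e) B)
              (NSPerturb.massMat α (D.matQ e) B) →
        (∃ lamHat, NSPerturb.IsClosest S (Λ i) lamHat) ∧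
        ∀ lamHat, NSPerturb.IsClosest S (Λ i) lamHat →
          ‖lamHat - Λ i‖ ≤ ((2 * (m : ℝ) - 1) * (C * κ)) / h * D.deltaSup φ ∧
          ((∀ j, Λ j ≠ Λ i → 2 * ((C * κ) / h * D.deltaSup φ) < ‖Λ j - Λ i‖) →
            ‖lamHat - Λ i‖ ≤ (C * κ) / h * D.deltaSup φ) := by
  obtain ⟨C, hC, hbound⟩ :=
    NSPerturb.Discretization.exists_abs_dotProduct_matN_mulVec_le r hσ
  refine ⟨2 * C, by positivity, ?_⟩
  rintro D h hh hq nu np m e F B V P Λ κ hV hκ i φ s hφ α S rfl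
  have hδ := D.deltaSup_nonneg φ
  have hQ := NSPerturb.Discretization.posDef_matQ hq hσ hh e
  have hQC := NSPerturb.posDef_toC hQ
  have hN := NSPerturb.norm_star_dotProduct_toC_mulVec_le hQ.posSemidef
    (K := C / h * D.deltaSup φ) (by positivity) (hbound D h hh hq nu e φ s hφ)
  have hηκ : 2 * (C / h * D.deltaSup φ) * κ = 2 * C * κ / h * D.deltaSup φ := by ring
  refine ⟨hV.exists_isClosest_saddle_add hQC α i, fun μ hμ => ?_⟩
  obtain ⟨hpath, hseparated⟩ := hV.norm_sub_le_of_isClosest hκ hQC (by positivity) hN i hμ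
  rw [hηκ] at hpath hseparated
  exact ⟨hpath.trans_eq (by ring), hseparated⟩

theorem mainTheorem1 (r : ℕ) (σ : ℝ) (hσ : 0 < σ) :
    ∃ C : ℝ, 0 < C ∧
      ∀ (D : NSPerturb.Discretization r) (h : ℝ), 0 < h → D.QuasiUniform σ h →
      ∀ β : ℝ, 0 < β → D.DivStable β →
      ∀ (ν : ℝ) (f w us : NSPerturb.Plane → NSPerturb.Plane)
        (ps : Lp ℝ 2 (volume.restrict (NSPerturb.domain D.mesh))),
        0 < ν → MemLp f 2 (volume.restrict D.dom) → D.IsSteadySolution ν f w us ps →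
      ∀ (nu np m : ℕ) (e : Module.Basis (Fin nu) ℝ D.X0) (g : Module.Basis (Fin np) ℝ D.Y)
        (V : Matrix (Fin nu) (Fin m) ℂ) (P : Matrix (Fin np) (Fin m) ℂ) (Λ : Fin m → ℂ) (κ : ℝ),
        NSPerturb.IsEigenbasis (D.matF ν us e) (D.matB e g) (D.matQ e) V P Λ →
        NSPerturb.CondLE (D.matQ e) V κ →
      ∀ lam : ℂ,
        NSPerturb.IsRightmost
          (NSPerturb.genSpectrum (NSPerturb.saddle (D.matF ν us e) (D.matB e g))
            (NSPerturb.massMat 0 (D.matQ e) (D.matB e g))) lam →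
      ∀ (φ : NSPerturb.Plane → ℝ) (s : ℕ), NSPerturb.IsFEFunction D.mesh s φ →
      ∀ (α : ℝ) (S : Set ℂ),
        S = NSPerturb.genSpectrum
              (NSPerturb.saddle (D.matF ν us e + D.matN φ e) (D.matB e g))
              (NSPerturb.massMat α (D.matQ e) (D.matB e g)) →
        (∃ lamHat, NSPerturb.IsClosest S lam lamHat) ∧
        ∀ lamHat, NSPerturb.IsClosest S lam lamHat →
          ‖lamHat - lam‖ ≤ ((2 * (m : ℝ) - 1) * (C * κ)) / h * D.deltaSup φ ∧
          ((∀ j, Λ j ≠ lam → 2 * ((C * κ) / h * D.deltaSup φ) < ‖Λ j - lam‖) →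
            ‖lamHat - lam‖ ≤ (C * κ) / h * D.deltaSup φ) := by
  obtain ⟨C, hC, hgeneral⟩ := mainTheorem1_general r hσ
  refine ⟨C, hC, ?_⟩
  intro D h hh hq _ _ _ ν _ _ us _ _ _ _ nu np m e g V P Λ κ hV hκ lam hlam φ s hφ α S hS
  obtain ⟨i, rfl⟩ := hV.exists_eq_of_isRightmost
    (NSPerturb.posDef_toC (NSPerturb.Discretization.posDef_matQ hq hσ hh e)) hlam
  exact hgeneral D h hh hq nu np m e _ _ V P Λ κ hV hκ i φ s hφ α S hS
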